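/- Let $P$ be the joint distribution of $(T,X,Y)$ (treatment, covariates, outcome) on $\mathbb{R}^{d_T}\times\mathbb{R}^{d_X}\times\mathbb{R}$, put $Z=(T,X)$, and let $P_{T,X},P_T,P_X,P_Y$ be its marginals and $P_{Y\mid T,X}$ the conditional distribution of $Y$ given $(T,X)$. Assume that the support $\mathcal{Z}$ of $P_{T,X}$ and the support of $P_Y$ are compact. Let $(T_i,X_i,Y_i)_{i\ge 1}$ be i.i.d. with distribution $P$, and let $Z_i=(T_i,X_i)$. Let $$Q_{T,X}=P_T\otimes P_X ,\qquad Q=P_T\otimes P_X\otimes P_{Y\mid T,X},$$ and assume overlap: $Q_{T,X}\ll P_{T,X}$ and $\frac{dQ_{T,X}}{dP_{T,X}}\le W_0$ $P_{T,X}$-almost surely, for some $W_0>0$. For a class $\mathcal{F}$ of real functions on $\mathcal{Z}$ let $\mathrm{IPM}_{\mathcal F}(\mu,\nu)=\sup_{f\in\mathcal F}\left|\int f\,d\mu-\int f\,d\nu\right|$. Suppose that $\mathcal F$ is one of the following: - the class of all functions on $\mathcal Z$ that are $1$-Lipschitz for the Euclidean distance, so that $\mathrm{IPM}_{\mathcal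 F}=\mathcal W_1$; - the unit ball of the reproducing kernel Hilbert space $\mathcal H$ of a universal kernel $\mathcal K$ on $\mathcal Z$ (that is, $\mathcal K$ is a continuous positive semidefinite kernel and every continuous function on $\mathcal Z$ is a uniform limit of elements of $\mathcal H$), so that $\mathrm{IPM}_{\mathcal F}=\mathrm{MMD}_{\mathcal K}$. Let $W>W_0$, let $\lambda\ge 0$, and let $\rho$ be strictly convex and continuous on $[0,W]$ and differentiable on $(0,W)$. For every $n\ge 1$ let the weights $w(n)=(w_1(n),\dots,w_n(n))$ be a measurable function of $(Z_1,\dots,Z_n)$ which almost surely is a minimizer of $$ \mathrm{IPM}_{\mathcal F}^2\Big(\sum_{i=1}^n w_i\,\delta_{Z_i},\ \hat P_T\otimes\hat P_X\Big)+\frac{\lambda}{n^2}\sum_{i=1}^n\rho(n w_i)$$ over all $w\in\mathbb{R}^n$ with $w_i\ge 0$, $\sum_{i=1}^n w_i=1$ and $w_i\le W/n$ for all $i$. Here $\hat P_T=\frac1n\sum_{i=1}^n\delta_{T_i}$ and $\hat P_X=\frac1n\sum_{i=1}^n\delta_{X_i}$ are the empirical marginals. Then, almost surely, $\sum_{i=1}^n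 w_i(n)\,\delta_{(Z_i,Y_i)}$ converges in distribution to $Q$ as $n\to\infty$. -/

import Mathlib

open MeasureTheory ProbabilityTheory Filter Topology
open scoped ENNReal

namespace CBDM

/-- The ambient space `ℝ^{d_T} × ℝ^{d_X}` of pairs `z = (t, x)` (treatment, covariates). -/
abbrev TX (dT dX : ℕ) : Type :=
  EuclideanSpace ℝ (Fin dT) × EuclideanSpace ℝ (Fin dX)

/-! ### Integral probability metrics -/

/-- `IPM_F(P₀, Q₀) = sup_{f ∈ F} |E_{P₀} f - E_{Q₀} f|`, with values in `[0, ∞]`. -/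
noncomputable def ipm {S : Type*} [MeasurableSpace S] (F : Set (S → ℝ)) (P₀ Q₀ : Measure S) :
    ℝ≥0∞ :=
  ⨆ f ∈ F, ENNReal.ofReal |(∫ s, f s ∂P₀) - ∫ s, f s ∂Q₀|

/-- The IPM over a class of functions defined on a subset `𝒵` of the ambient space, for measures
on the ambient space which are carried by `𝒵` (they are viewed as measures on `𝒵`). -/
noncomputable def ipmOn {S : Type*} [MeasurableSpace S] (𝒵 : Set S) (F : Set (𝒵 → ℝ))
    (P₀ Q₀ : Measure S) : ℝ≥0∞ :=
  ipm F (P₀.comap (Subtype.val : 𝒵 → S)) (Q₀.comap (Subtype.val : 𝒵 → S))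

/-- The functions on `𝒵` which are `1`-Lipschitz for the Euclidean distance of
`ℝ^{d_T} × ℝ^{d_X}`; the corresponding IPM is the Wasserstein distance `W₁`. -/
def lipschitzClass {dT dX : ℕ} (𝒵 : Set (TX dT dX)) : Set (𝒵 → ℝ) :=
  {f | ∀ z z' : 𝒵, |f z - f z'| ≤ dist (WithLp.toLp 2 (z : TX dT dX)) (WithLp.toLp 2 (z' : TX dT dX))}

/-! ### Kernels, their RKHS, and universality -/

/-- A (real positive semidefinite) kernel on `S`: a symmetric function with
`∑ i, ∑ j, c i * c j * K (s i) (s j) ≥ 0` for all finite families. -/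
def IsKernel {S : Type*} (K : S → S → ℝ) : Prop := (Matrix.of K).PosSemidef

/-- The scalar kernel `K` as the operator-valued kernel `(s, s') ↦ K s s' • id` on `ℝ`. -/
noncomputable def operatorKernel {S : Type*} (K : S → S → ℝ) : Matrix S S (ℝ →L[ℝ] ℝ) :=
  Matrix.of fun s s' => K s s' • ContinuousLinearMap.id ℝ ℝ

theorem IsKernel.operatorKernel_posSemidef {S : Type*} {K : S → S → ℝ} (hK : IsKernel K) :
    (operatorKernel K).PosSemidef := by
  have key := (RKHS.posSemidef_tfae (K := operatorKernel K)).out 0 2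
  rw [key]
  refine ⟨?_, fun v => ?_⟩
  · ext s s'
    have h : K s' s = K s s' := by simpa using hK.1.apply s s'
    have hid : star (ContinuousLinearMap.id ℝ ℝ) = ContinuousLinearMap.id ℝ ℝ :=
      star_one (ℝ →L[ℝ] ℝ)
    simp [operatorKernel, Matrix.conjTranspose_apply, h, hid]
  · have h := hK.2 v
    have e : ∀ x x' : S, K x x' = K x' x := fun x x' => by simpa using hK.1.apply x' x
    refine h.trans_eq ?_
    simp only [operatorKernel, Matrix.of_apply, RCLike.re_to_real]
    refine Finsupp.sum_congr fun x _ => Finsupp.sum_congr fun x' _ => ?_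
    simp [e x x']
    ring

/-- The set of functions on `S` which belong to the RKHS of the kernel `K` and have RKHS norm
at most `r`. -/
def rkhsBall {S : Type*} (K : S → S → ℝ) (hK : IsKernel K) (r : ℝ) : Set (S → ℝ) :=
  haveI : Fact (operatorKernel K).PosSemidef := ⟨hK.operatorKernel_posSemidef⟩
  {f | ∃ h : RKHS.OfKernel (operatorKernel K), ‖h‖ ≤ r ∧ ⇑h = f}

/-- The unit ball of the RKHS of `K`; the corresponding IPM is `MMD_K`. -/
def mmdClass {S : Type*} (K : S → S → ℝ) (hK : IsKernel K) : Set (S → ℝ) :=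
  rkhsBall K hK 1

/-- `K` is universal on the (compact) space `S`: it is continuous, and every continuous function
on `S` is a uniform limit of functions of the RKHS of `K`. -/
def IsUniversal {S : Type*} [TopologicalSpace S] (K : S → S → ℝ) (hK : IsKernel K) : Prop :=
  Continuous (fun p : S × S => K p.1 p.2) ∧
    ∀ g : S → ℝ, Continuous g → ∀ ε > 0, ∃ r : ℝ, ∃ f ∈ rkhsBall K hK r, ∀ s, |g s - f s| ≤ ε

/-! ### Weighted empirical distributions -/

/-- The weighted empirical distribution `∑ i, w i • δ_{s i}` (for nonnegative weights). -/
noncomputable def weightedEmpirical {S : Type*} [MeasurableSpace S] {n : ℕ} (w : Fin n → ℝ)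
    (s : Fin n → S) : FiniteMeasure S :=
  ⟨∑ i, ENNReal.ofReal (w i) • Measure.dirac (s i), ⟨by
    simp only [Measure.coe_finsetSum, Measure.coe_smul, Finset.sum_apply, Pi.smul_apply,
      measure_univ, smul_eq_mul, mul_one]
    exact ENNReal.sum_lt_top.2 fun i _ => ENNReal.ofReal_lt_top⟩⟩

/-- The empirical distribution `n⁻¹ ∑ i, δ_{s i}`. -/
noncomputable def empirical {S : Type*} [MeasurableSpace S] {n : ℕ} (s : Fin n → S) :
    FiniteMeasure S :=
  weightedEmpirical (fun _ => (n : ℝ)⁻¹) s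

/-- `Q̂ = P̂_T ⊗ P̂_X`: the product of the empirical distributions of the treatments and of the
covariates. -/
noncomputable def productEmpirical {dT dX n : ℕ} (z : Fin n → TX dT dX) : Measure (TX dT dX) :=
  (empirical fun i => (z i).1 : Measure (EuclideanSpace ℝ (Fin dT))).prod
    (empirical fun i => (z i).2 : Measure (EuclideanSpace ℝ (Fin dX)))

/-! ### The weights -/

/-- The regularizer `R_n(w) = n⁻² ∑ i, ρ (n * w i)`. -/
noncomputable def regularizer (ρ : ℝ → ℝ) {n : ℕ} (w : Fin n → ℝ) : ℝ :=
  ((n : ℝ) ^ 2)⁻¹ * ∑ i, ρ (n * w i)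

/-- The feasible set: the vectors of the simplex `Λ_n` with `w i ≤ W / n` for all `i`. -/
def feasible (W : ℝ) (n : ℕ) : Set (Fin n → ℝ) :=
  {w | w ∈ stdSimplex ℝ (Fin n) ∧ ∀ i, w i ≤ W / n}

/-- The objective `IPM_F(P̂^w_{T,X}, Q̂_{T,X})² + lam * R_n(w)`, where `Q̂_{T,X} = P̂_T ⊗ P̂_X`. -/
noncomputable def objective {dT dX n : ℕ} (𝒵 : Set (TX dT dX)) (F : Set (𝒵 → ℝ)) (ρ : ℝ → ℝ)
    (lam : ℝ) (z : Fin n → TX dT dX) (w : Fin n → ℝ) : EReal :=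
  ((ipmOn 𝒵 F (weightedEmpirical w z) (productEmpirical z) ^ 2 : ℝ≥0∞) : EReal) +
    ((lam * regularizer ρ w : ℝ) : EReal)

/-- `w` is a vector of CBDM weights for the data `z = (z i)`: a minimizer of the objective over
the feasible set. -/
def IsCBDMWeights {dT dX n : ℕ} (𝒵 : Set (TX dT dX)) (F : Set (𝒵 → ℝ)) (ρ : ℝ → ℝ)
    (lam W : ℝ) (z : Fin n → TX dT dX) (w : Fin n → ℝ) : Prop :=
  w ∈ feasible W n ∧ IsMinOn (objective 𝒵 F ρ lam z) (feasible W n) w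

/-! ### The observational and the interventional distribution -/

/-- `Q_{T,X} = P_T ⊗ P_X`, for `P` the joint distribution of `((T, X), Y)`. -/
noncomputable def targetTX {dT dX : ℕ} (P : Measure (TX dT dX × ℝ)) : Measure (TX dT dX) :=
  P.fst.fst.prod P.fst.snd

/-- The interventional distribution `Q = P_T ⊗ P_X ⊗ P_{Y|T,X}`, where `P.condKernel` is a regular
version of the conditional distribution `P_{Y|T,X}`. -/
noncomputable def interventional {dT dX : ℕ} (P : Measure (TX dT dX × ℝ))
    [IsProbabilityMeasure P] : ProbabilityMeasure (TX dT dX × ℝ) :=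
  ⟨targetTX P ⊗ₘ P.condKernel, by unfold targetTX; infer_instance⟩

end CBDM

namespace CBDM

/-! The minimizer is compared with an oracle. Let `r ≤ W₀` be the density of `P_T ⊗ P_X` with
respect to `P_{T,X}`. The normalized importance weights `r (Z i) / ∑ j, r (Z j)` are eventually
feasible, because their normalizer is asymptotic to `n` and `W₀ < W`. By the strong law their
weighted empirical measure tends weakly to `P_T ⊗ P_X`, and so does the product of the empirical
marginals, hence their IPM tends to `0`. The penalty is `O(1/n)` uniformly on the feasible set, so
minimality forces the IPM of the CBDM weights to `0` as well (`tendsto_sum_of_isCBDMWeights`).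

Both function classes enter only through `IsControlled`. A common modulus of continuity makes weak
convergence imply IPM convergence (`IsControlled.tendsto_ipm`); density of the multiples gives the
converse (`IsControlled.tendsto_integral_sub`).

For the outcomes, a test function is split as `h (z, y) = m z + (h (z, y) - m z)` with `m z = E[h
(z, Y) | Z = z]`. The function `m` is only bounded and measurable, so weak convergence does not
apply to it directly; the cap `w i ≤ W / n` bounds the cost of an `L¹(P)` approximation by
continuous functions (`ae_tendsto_sum_of_measurable`). Given all the covariates, the weights are
constants and the remainders are independent and centred, so Hoeffding and Borel–Cantelli dispose of
the noise (`ae_tendsto_weighted_sum_sub`).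

Compactness of the supports reduces weak convergence to countably many test functions, hence to a
single null set (`exists_seq_forall_tendsto`). -/

/-! ### Weak convergence on a compact carrier -/

theorem tendsto_of_forall_approx {ι : Type*} {l : Filter ι} {a : ι → ℝ} {x : ℝ}
    (h : ∀ ε > 0, ∃ (b : ι → ℝ) (y : ℝ), Tendsto b l (𝓝 y) ∧ (∀ᶠ n in l, |a n - b n| ≤ ε) ∧
      |x - y| ≤ ε) : Tendsto a l (𝓝 x) := by
  rw [Metric.tendsto_nhds]
  intro ε hε
  obtain ⟨b, y, hb, hab, hxy⟩ := h (ε / 4) (by positivity)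
  filter_upwards [Metric.tendsto_nhds.1 hb (ε / 4) (by positivity), hab] with n h1 h2
  rw [Real.dist_eq] at *
  rw [abs_le] at h2 hxy
  rw [abs_lt] at *
  constructor <;> linarith [h1.1, h1.2, h2.1, h2.2, hxy.1, hxy.2]

/-- The integrals of two integrable functions which are uniformly close on a carrier of the
measure are close. -/
theorem abs_integral_sub_le_of_forall_mem {S : Type*} [MeasurableSpace S] {ν : Measure S}
    [IsFiniteMeasure ν] {K : Set S} (hν : ν Kᶜ = 0) {f g : S → ℝ} (hf : Integrable f ν)
    (hg : Integrable g ν) {ε : ℝ} (h : ∀ x ∈ K, |f x - g x| ≤ ε) :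
    |(∫ x, f x ∂ν) - ∫ x, g x ∂ν| ≤ ε * ν.real Set.univ := by
  rw [← integral_sub hf hg, ← Real.norm_eq_abs]
  refine norm_integral_le_of_norm_le_const ?_
  have : ∀ᵐ x ∂ν, x ∈ K := hν
  filter_upwards [this] with x hx using h x hx

theorem exists_boundedContinuousFunction_eqOn {S : Type*} [MetricSpace S] {K : Set S}
    (hK : IsCompact K) (g : C(K, ℝ)) : ∃ f : BoundedContinuousFunction S ℝ, ∀ x : K, f x = g x := by
  have : CompactSpace K := isCompact_iff_compactSpace.1 hK
  obtain ⟨f, -, hf⟩ := BoundedContinuousFunction.exists_extension_norm_eq_of_isClosedEmbedding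
    (BoundedContinuousFunction.mkOfCompact g) hK.isClosed.isClosedEmbedding_subtypeVal
  exact ⟨f, fun x => congrFun hf x⟩

/-- On measures carried by a compact set, weak convergence is determined by countably many
bounded continuous functions. -/
theorem exists_seq_forall_tendsto {S : Type*} [MetricSpace S] [MeasurableSpace S] [BorelSpace S]
    {K : Set S} (hK : IsCompact K) :
    ∃ g : ℕ → BoundedContinuousFunction S ℝ, ∀ (ν : ℕ → FiniteMeasure S) (ν' : FiniteMeasure S)
      (M : ℝ), (∀ᶠ n in atTop, (ν n : Measure S) Kᶜ = 0) → (ν' : Measure S) Kᶜ = 0 →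
      (∀ᶠ n in atTop, (ν n : Measure S).real Set.univ ≤ M) →
      (∀ k, Tendsto (fun n => ∫ x, g k x ∂(ν n : Measure S)) atTop
        (𝓝 (∫ x, g k x ∂(ν' : Measure S)))) →
      Tendsto ν atTop (𝓝 ν') := by
  have : CompactSpace K := isCompact_iff_compactSpace.1 hK
  choose ext hext using fun g : C(K, ℝ) => exists_boundedContinuousFunction_eqOn hK g
  -- A dense sequence of the separable space `C(K, ℝ)`, extended by Tietze. It is fixed before the
  -- measures are, so the same sequence serves for every `ω`.
  refine ⟨fun k => ext (TopologicalSpace.denseSeq C(K, ℝ) k), fun ν ν' M hν hν' hM h => ?_⟩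
  rw [FiniteMeasure.tendsto_iff_forall_integral_tendsto]
  intro f
  refine tendsto_of_forall_approx fun ε hε => ?_
  set M' := max 1 (max M ((ν' : Measure S).real Set.univ)) with hM'
  have hM'0 : 0 < M' := lt_of_lt_of_le one_pos (le_max_left _ _)
  let fK : C(K, ℝ) := ⟨fun x => f x, by fun_prop⟩
  obtain ⟨k, hk⟩ := Metric.denseRange_iff.1 (TopologicalSpace.denseRange_denseSeq C(K, ℝ)) fK
    (ε / M') (by positivity)
  have hclose : ∀ x ∈ K, |f x - ext (TopologicalSpace.denseSeq C(K, ℝ) k) x| ≤ ε / M' := by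
    intro x hx
    have h1 := ContinuousMap.dist_apply_le_dist (f := fK)
      (g := TopologicalSpace.denseSeq C(K, ℝ) k) ⟨x, hx⟩
    rw [Real.dist_eq, ← hext (TopologicalSpace.denseSeq C(K, ℝ) k) ⟨x, hx⟩] at h1
    exact h1.trans hk.le
  have hint : ∀ (κ : Measure S) [IsFiniteMeasure κ], κ Kᶜ = 0 → κ.real Set.univ ≤ M' →
      |(∫ x, f x ∂κ) - ∫ x, ext (TopologicalSpace.denseSeq C(K, ℝ) k) x ∂κ| ≤ ε := by
    intro κ _ h1 h2
    refine (abs_integral_sub_le_of_forall_mem h1 (f.integrable κ)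
      ((ext (TopologicalSpace.denseSeq C(K, ℝ) k)).integrable κ) hclose).trans ?_
    calc ε / M' * κ.real Set.univ ≤ ε / M' * M' := by gcongr
      _ = ε := by field_simp
  refine ⟨_, _, h k, ?_, hint _ hν' ((le_max_right _ _).trans (le_max_right _ _))⟩
  filter_upwards [hν, hM] with n h1 h2
  exact hint _ h1 (h2.trans ((le_max_left _ _).trans (le_max_right _ _)))

/-! ### IPM convergence versus weak convergence -/

/-- A class of functions with a common continuous modulus, whose multiples are uniformly dense in
the continuous functions. -/
structure IsControlled {X : Type*} [TopologicalSpace X] (F : Set (X → ℝ)) : Prop where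
  exists_modulus : ∃ δ : X → X → ℝ, Continuous (fun p : X × X => δ p.1 p.2) ∧ (∀ z, δ z z = 0) ∧
    ∀ f ∈ F, ∀ z z', |f z - f z'| ≤ δ z z'
  exists_approx : ∀ g : X → ℝ, Continuous g → ∀ ε > 0, ∃ c : ℝ, ∃ f ∈ F, ∀ x, |g x - c * f x| ≤ ε

theorem IsControlled.continuous {X : Type*} [TopologicalSpace X] {F : Set (X → ℝ)}
    (hF : IsControlled F) {f : X → ℝ} (hf : f ∈ F) : Continuous f := by
  obtain ⟨δ, hδ, hδ0, h⟩ := hF.exists_modulus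
  rw [continuous_iff_continuousAt]
  intro z
  rw [ContinuousAt, tendsto_iff_dist_tendsto_zero]
  have h1 : Tendsto (fun z' => δ z' z) (𝓝 z) (𝓝 0) := by
    rw [← hδ0 z]
    exact (hδ.comp (by fun_prop : Continuous fun z' => (z', z))).tendsto z
  exact squeeze_zero (fun _ => dist_nonneg) (fun z' => h f hf z' z) h1

/-- The IPM dominates the discrepancy of each single `f ∈ F`, hence of its multiples, and these
approximate `g` uniformly. Both sequences may vary with `n`; no limit measure is involved. -/
theorem IsControlled.tendsto_integral_sub {X : Type*} [TopologicalSpace X] [CompactSpace X]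
    [MeasurableSpace X] [BorelSpace X] {F : Set (X → ℝ)} (hF : IsControlled F)
    {μ ν : ℕ → Measure X} (hμ : ∀ᶠ n in atTop, IsProbabilityMeasure (μ n))
    (hν : ∀ᶠ n in atTop, IsProbabilityMeasure (ν n))
    (h : Tendsto (fun n => ipm F (μ n) (ν n)) atTop (𝓝 0)) {g : X → ℝ} (hg : Continuous g) :
    Tendsto (fun n => (∫ x, g x ∂μ n) - ∫ x, g x ∂ν n) atTop (𝓝 0) := by
  refine tendsto_of_forall_approx fun ε hε => ?_
  obtain ⟨c, f, hf, hfg⟩ := hF.exists_approx g hg (ε / 2) (by positivity)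
  have hint : ∀ {f : X → ℝ} (_ : Continuous f) (κ : Measure X) [IsFiniteMeasure κ],
      Integrable f κ := fun hf κ _ => hf.integrable_of_hasCompactSupport (HasCompactSupport.of_compactSpace _)
  refine ⟨fun n => c * ((∫ x, f x ∂μ n) - ∫ x, f x ∂ν n), 0, ?_, ?_, by simpa using hε.le⟩
  · rw [← mul_zero c]
    refine Tendsto.const_mul c ?_
    have h0 : Tendsto (fun n => ENNReal.ofReal |(∫ x, f x ∂μ n) - ∫ x, f x ∂ν n|) atTop (𝓝 0) :=
      tendsto_of_tendsto_of_tendsto_of_le_of_le tendsto_const_nhds h (fun _ => zero_le)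
        fun n => le_iSup₂ (f := fun f (_ : f ∈ F) =>
          ENNReal.ofReal |(∫ x, f x ∂μ n) - ∫ x, f x ∂ν n|) f hf
    have h1 := (ENNReal.tendsto_toReal ENNReal.zero_ne_top).comp h0
    rw [tendsto_zero_iff_abs_tendsto_zero]
    simpa [Function.comp_def] using h1
  · filter_upwards [hμ, hν] with n _ _
    have hc : Continuous fun x => c * f x := (hF.continuous hf).const_mul c
    have h1 := abs_integral_sub_le_of_forall_mem (ν := μ n) (K := Set.univ) (by simp)
      (hint hg _) (hint hc _) fun x _ => hfg x
    have h2 := abs_integral_sub_le_of_forall_mem (ν := ν n) (K := Set.univ) (by simp)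
      (hint hg _) (hint hc _) fun x _ => hfg x
    rw [integral_const_mul] at h1 h2
    simp only [probReal_univ, mul_one] at h1 h2
    rw [abs_le] at *
    constructor <;> linarith [h1.1, h1.2, h2.1, h2.2]

/-- Equicontinuity makes the convergence uniform over `F`: one finite partition of unity
approximates all `f ∈ F` at once, with bounded coefficients, so only finitely many integrals need to
converge. -/
theorem IsControlled.tendsto_ipm {X : Type*} [TopologicalSpace X] [CompactSpace X] [T2Space X]
    [MeasurableSpace X] [BorelSpace X] {F : Set (X → ℝ)} (hF : IsControlled F)
    {μ ν : ℕ → Measure X} (hμ : ∀ᶠ n in atTop, IsProbabilityMeasure (μ n))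
    (hν : ∀ᶠ n in atTop, IsProbabilityMeasure (ν n))
    (h : ∀ g : X → ℝ, Continuous g →
      Tendsto (fun n => (∫ x, g x ∂μ n) - ∫ x, g x ∂ν n) atTop (𝓝 0)) :
    Tendsto (fun n => ipm F (μ n) (ν n)) atTop (𝓝 0) := by
  obtain ⟨δ, hδ, hδ0, hδF⟩ := hF.exists_modulus
  have hint : ∀ {f : X → ℝ} (_ : Continuous f) (κ : Measure X) [IsFiniteMeasure κ],
      Integrable f κ := fun hf κ _ => hf.integrable_of_hasCompactSupport (HasCompactSupport.of_compactSpace _)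
  rcases isEmpty_or_nonempty X with hX | ⟨⟨z₀⟩⟩
  · obtain ⟨n, hn⟩ := hμ.exists
    exact absurd hn.measure_univ (by simp [Set.eq_empty_of_isEmpty])
  rw [ENNReal.tendsto_nhds_zero]
  intro η hη
  -- The three errors are the approximation under `μ n`, the one under `ν n`, and the discrepancy of
  -- the finite sums. The value `η = ∞` is treated apart.
  obtain ⟨ε, hε, hεη⟩ : ∃ ε : ℝ, 0 < ε ∧ ENNReal.ofReal (3 * ε) ≤ η := by
    rcases eq_or_ne η ∞ with rfl | hη'
    · exact ⟨1, one_pos, le_top⟩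
    · refine ⟨η.toReal / 3, by have := ENNReal.toReal_pos hη.ne' hη'; positivity, ?_⟩
      rw [mul_div_cancel₀ _ (by norm_num), ENNReal.ofReal_toReal hη']
  have hopen : ∀ z, IsOpen {x | δ x z < ε} := fun z =>
    isOpen_lt (hδ.comp (by fun_prop : Continuous fun x => (x, z))) continuous_const
  obtain ⟨s, hs⟩ := isCompact_univ.elim_finite_subcover (fun z => {x | δ x z < ε}) hopen
    fun z _ => Set.mem_iUnion.2 ⟨z, by simpa [hδ0] using hε⟩
  obtain ⟨φ, hφ⟩ := PartitionOfUnity.exists_isSubordinate (s := (Set.univ : Set X)) isClosed_univ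
    (fun z : s => {x | δ x (z : X) < ε}) (fun z => hopen z) (fun x hx => by simpa using hs hx)
  obtain ⟨C, hC⟩ : ∃ C : ℝ, ∀ z, δ z z₀ ≤ C := by
    obtain ⟨C, hC⟩ := (isCompact_range
      (hδ.comp (by fun_prop : Continuous fun x => (x, z₀)))).bddAbove
    exact ⟨C, fun z => hC ⟨z, rfl⟩⟩
  have hlim : Tendsto (fun n => ∑ i, C * |(∫ x, φ i x ∂μ n) - ∫ x, φ i x ∂ν n|) atTop (𝓝 0) := by
    rw [← Finset.sum_const_zero (s := (Finset.univ : Finset s))]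
    refine tendsto_finsetSum _ fun i _ => ?_
    rw [← mul_zero C]
    exact ((tendsto_zero_iff_abs_tendsto_zero _).1 (h _ (φ i).continuous)).const_mul C
  filter_upwards [hμ, hν, hlim.eventually_le_const hε] with n _ _ hn
  refine iSup₂_le fun f hf => (ENNReal.ofReal_le_ofReal ?_).trans hεη
  have hfc := hF.continuous hf
  have hsum : ∀ x, ∑ i, φ i x = 1 := fun x => by
    rw [← finsum_eq_sum_of_fintype]; exact φ.sum_eq_one (Set.mem_univ x)
  -- The class may contain all constants, so `f` itself has no uniform bound. Subtracting `f z₀`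
  -- makes the coefficients at most `C` and cancels between two probability measures.
  have happ : ∀ x, |(f x - f z₀) - ∑ i : s, (f i - f z₀) * φ i x| ≤ ε := by
    intro x
    have e : (f x - f z₀) - ∑ i : s, (f i - f z₀) * φ i x = ∑ i : s, (f x - f i) * φ i x := by
      calc _ = (f x - f z₀) * (∑ i, φ i x) - ∑ i : s, (f i - f z₀) * φ i x := by
            rw [hsum, mul_one]
        _ = _ := by
          rw [Finset.mul_sum, ← Finset.sum_sub_distrib]
          exact Finset.sum_congr rfl fun i _ => by ring
    rw [e]
    calc _ ≤ ∑ i : s, |(f x - f i) * φ i x| := Finset.abs_sum_le_sum_abs _ _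
      _ ≤ ∑ i : s, ε * φ i x := by
        refine Finset.sum_le_sum fun i _ => ?_
        rw [abs_mul, abs_of_nonneg (φ.nonneg i x)]
        by_cases hx : φ i x = 0
        · simp [hx]
        · have : x ∈ {x | δ x (i : X) < ε} := hφ i (subset_tsupport _ hx)
          exact mul_le_mul_of_nonneg_right ((hδF f hf x i).trans (le_of_lt this)) (φ.nonneg i x)
      _ = ε := by rw [← Finset.mul_sum, hsum, mul_one]
  have hc1 : Continuous fun x => f x - f z₀ := by fun_prop
  have hc2 : Continuous fun x => ∑ i : s, (f i - f z₀) * φ i x := by fun_prop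
  have hsumint : ∀ (κ : Measure X) [IsFiniteMeasure κ],
      ∫ x, ∑ i : s, (f i - f z₀) * φ i x ∂κ = ∑ i : s, (f i - f z₀) * ∫ x, φ i x ∂κ := by
    intro κ _
    rw [integral_finsetSum _ fun i _ => hint (by fun_prop) κ]
    exact Finset.sum_congr rfl fun i _ => integral_const_mul _ _
  have hshift : ∀ (κ : Measure X) [IsProbabilityMeasure κ],
      ∫ x, (f x - f z₀) ∂κ = (∫ x, f x ∂κ) - f z₀ := by
    intro κ _
    rw [integral_sub (hint hfc κ) (integrable_const _)]; simp
  have h1 := abs_integral_sub_le_of_forall_mem (ν := μ n) (K := Set.univ) (by simp)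
    (hint hc1 _) (hint hc2 _) fun x _ => happ x
  have h2 := abs_integral_sub_le_of_forall_mem (ν := ν n) (K := Set.univ) (by simp)
    (hint hc1 _) (hint hc2 _) fun x _ => happ x
  rw [hsumint, hshift, probReal_univ, mul_one] at h1 h2
  have h3 : |(∑ i : s, (f i - f z₀) * ∫ x, φ i x ∂μ n) - ∑ i : s, (f i - f z₀) * ∫ x, φ i x ∂ν n|
      ≤ ε := by
    rw [← Finset.sum_sub_distrib]
    refine (Finset.abs_sum_le_sum_abs _ _).trans (le_trans (Finset.sum_le_sum fun i _ => ?_) hn)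
    rw [← mul_sub, abs_mul]
    exact mul_le_mul_of_nonneg_right ((hδF f hf i z₀).trans (hC i)) (abs_nonneg _)
  rw [abs_le] at *
  constructor <;> linarith [h1.1, h1.2, h2.1, h2.2, h3.1, h3.2]

/-! ### The Wasserstein and MMD classes -/

/-- Lipschitz functions are uniformly dense in the continuous functions on a compact space. -/
theorem exists_lipschitz_approx {X : Type*} [MetricSpace X] [CompactSpace X] {g : X → ℝ}
    (hg : Continuous g) {ε : ℝ} (hε : 0 < ε) :
    ∃ L > 0, ∃ h : X → ℝ, (∀ x y, |h x - h y| ≤ L * dist x y) ∧ ∀ x, |g x - h x| ≤ ε := by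
  rcases isEmpty_or_nonempty X with hX | hX
  · exact ⟨1, one_pos, g, fun x => (hX.false x).elim, fun x => (hX.false x).elim⟩
  obtain ⟨M, hM⟩ : ∃ M, ∀ x, |g x| ≤ M := by
    obtain ⟨M, hM⟩ := (isCompact_range hg.abs).bddAbove
    exact ⟨M, fun x => hM ⟨x, rfl⟩⟩
  have hM0 : 0 ≤ M := (abs_nonneg _).trans (hM hX.some)
  obtain ⟨η, hη, hη'⟩ := Metric.uniformContinuous_iff.1
    (CompactSpace.uniformContinuous_of_continuous hg) ε hε
  -- The approximant is the infimal convolution of `g` with `L * dist`. At distance at least `η` the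
  -- penalty is at least `2 * M + 1`, more than the oscillation of `g`; closer points change `g` by
  -- less than `ε`. The `+ 1` keeps `L` positive.
  set L := (2 * M + 1) / η with hL
  have hL0 : 0 < L := by positivity
  have hbdd : ∀ x, BddBelow (Set.range fun y => g y + L * dist x y) := fun x =>
    ⟨-M, by
      rintro _ ⟨y, rfl⟩
      have h1 := (abs_le.1 (hM y)).1
      have h2 : 0 ≤ L * dist x y := by positivity
      simp only; linarith⟩
  have hle : ∀ x x', (⨅ y, g y + L * dist x y) ≤ (⨅ y, g y + L * dist x' y) + L * dist x x' := by
    intro x x'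
    rw [← sub_le_iff_le_add]
    refine le_ciInf fun y => ?_
    rw [sub_le_iff_le_add]
    refine (ciInf_le (hbdd x) y).trans ?_
    have : L * dist x y ≤ L * (dist x x' + dist x' y) := by gcongr; exact dist_triangle _ _ _
    linarith
  refine ⟨L, hL0, fun x => ⨅ y, g y + L * dist x y, fun x x' => ?_, fun x => ?_⟩
  · rw [abs_le]
    have h1 := hle x x'
    have h2 := hle x' x
    rw [dist_comm x' x] at h2
    constructor <;> simp only <;> linarith
  · have h1 : (⨅ y, g y + L * dist x y) ≤ g x := (ciInf_le (hbdd x) x).trans (by simp)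
    have h2 : g x - ε ≤ ⨅ y, g y + L * dist x y := by
      refine le_ciInf fun y => ?_
      rcases lt_or_ge (dist x y) η with h | h
      · have h3 := hη' h
        rw [Real.dist_eq, abs_lt] at h3
        have h4 : 0 ≤ L * dist x y := by positivity
        linarith [h3.1, h3.2]
      · have h3 : L * η ≤ L * dist x y := by gcongr
        have h4 : L * η = 2 * M + 1 := by rw [hL]; field_simp
        have h5 := (abs_le.1 (hM y)).1
        have h6 := (abs_le.1 (hM x)).2
        linarith
    rw [abs_le]
    constructor <;> linarith

theorem isControlled_lipschitzClass {dT dX : ℕ} {𝒵 : Set (TX dT dX)} (h𝒵 : IsCompact 𝒵) :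
    IsControlled (lipschitzClass 𝒵) := by
  have : CompactSpace 𝒵 := isCompact_iff_compactSpace.1 h𝒵
  refine ⟨⟨fun z z' => dist (WithLp.toLp 2 (z : TX dT dX)) (WithLp.toLp 2 (z' : TX dT dX)),
    ?_, fun z => dist_self _, fun f hf z z' => hf z z'⟩, fun g hg ε hε => ?_⟩
  · have h := WithLp.prod_continuous_toLp 2 (EuclideanSpace ℝ (Fin dT)) (EuclideanSpace ℝ (Fin dX))
    exact (h.comp (by fun_prop : Continuous fun p : 𝒵 × 𝒵 => (p.1 : TX dT dX))).dist
      (h.comp (by fun_prop : Continuous fun p : 𝒵 × 𝒵 => (p.2 : TX dT dX)))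
  · obtain ⟨L, hL, h, hh, hgh⟩ := exists_lipschitz_approx hg hε
    refine ⟨L, fun x => L⁻¹ * h x, fun z z' => ?_, fun x => ?_⟩
    · rw [← mul_sub, abs_mul, abs_of_pos (inv_pos.2 hL), inv_mul_le_iff₀ hL]
      refine (hh z z').trans ?_
      -- The metric of the product space is the sup distance, which the Euclidean distance
      -- dominates.
      gcongr
      have := (WithLp.prod_lipschitzWith_ofLp 2 (EuclideanSpace ℝ (Fin dT))
        (EuclideanSpace ℝ (Fin dX))).dist_le_mul (WithLp.toLp 2 (z : TX dT dX))
        (WithLp.toLp 2 (z' : TX dT dX))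
      simpa [Subtype.dist_eq] using this
    · rw [mul_inv_cancel_left₀ hL.ne']
      exact hgh x

/-- The canonical modulus of continuity of the unit ball of an RKHS. -/
theorem abs_sub_le_of_mem_mmdClass {S : Type*} {K : S → S → ℝ} {hK : IsKernel K} {f : S → ℝ}
    (hf : f ∈ mmdClass K hK) (s s' : S) :
    |f s - f s'| ≤ √(K s s - 2 * K s s' + K s' s') := by
  have : Fact (operatorKernel K).PosSemidef := ⟨hK.operatorKernel_posSemidef⟩
  obtain ⟨h, hh, rfl⟩ := hf
  have hk : ∀ x y : S, inner ℝ (RKHS.kerFun (RKHS.OfKernel (operatorKernel K)) y (1 : ℝ))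
      (RKHS.kerFun (RKHS.OfKernel (operatorKernel K)) x (1 : ℝ)) = K x y := by
    intro x y
    rw [← RKHS.kernel_inner, RKHS.OfKernel.kernel_ofKernel]
    simp [operatorKernel]
  have hev : ∀ x : S, h x = inner ℝ (RKHS.kerFun (RKHS.OfKernel (operatorKernel K)) x (1 : ℝ)) h := by
    intro x
    rw [RKHS.kerFun_inner]
    simp
  have hsym : K s' s = K s s' := by simpa using hK.1.apply s s'
  -- By the reproducing property the increment is the inner product of `h` with a difference of two
  -- kernel sections; Cauchy–Schwarz concludes.
  rw [hev, hev, ← inner_sub_left]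
  refine (abs_real_inner_le_norm _ _).trans ((mul_le_of_le_one_right (norm_nonneg _) hh).trans ?_)
  refine Real.le_sqrt_of_sq_le (le_of_eq ?_)
  rw [norm_sub_sq_real, ← real_inner_self_eq_norm_sq, ← real_inner_self_eq_norm_sq, hk, hk, hk, hsym]

theorem isControlled_mmdClass {S : Type*} [TopologicalSpace S] {K : S → S → ℝ} {hK : IsKernel K}
    (hU : IsUniversal K hK) : IsControlled (mmdClass K hK) := by
  obtain ⟨hc, hd⟩ := hU
  refine ⟨⟨fun s s' => √(K s s - 2 * K s s' + K s' s'), ?_, fun s => ?_,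
    fun f hf s s' => abs_sub_le_of_mem_mmdClass hf s s'⟩, fun g hg ε hε => ?_⟩
  · have h1 : Continuous fun p : S × S => K p.1 p.1 :=
      hc.comp (by fun_prop : Continuous fun p : S × S => (p.1, p.1))
    have h2 : Continuous fun p : S × S => K p.2 p.2 :=
      hc.comp (by fun_prop : Continuous fun p : S × S => (p.2, p.2))
    fun_prop
  · ring_nf; simp
  · have : Fact (operatorKernel K).PosSemidef := ⟨hK.operatorKernel_posSemidef⟩
    obtain ⟨r, f, ⟨h, -, rfl⟩, hgf⟩ := hd g hg ε hε
    -- Universality gives approximants of arbitrary norm; dividing by `‖h‖ + 1`, which is never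
    -- zero, brings them into the unit ball.
    refine ⟨‖h‖ + 1, ⇑((‖h‖ + 1)⁻¹ • h), ⟨(‖h‖ + 1)⁻¹ • h, ?_, rfl⟩, fun x => ?_⟩
    · rw [norm_smul, norm_inv, Real.norm_of_nonneg (by positivity), inv_mul_le_iff₀ (by positivity)]
      linarith
    · rw [RKHS.coe_smul, Pi.smul_apply, smul_eq_mul, mul_inv_cancel_left₀ (by positivity)]
      exact hgf x

/-! ### Transfer between `𝒵` and the ambient space -/

section Ambient

variable {S : Type*} [MeasurableSpace S] {𝒵 : Set S}

theorem isProbabilityMeasure_comap_subtypeVal (h𝒵 : MeasurableSet 𝒵) {μ : Measure S}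
    [IsProbabilityMeasure μ] (hμ : μ 𝒵ᶜ = 0) :
    IsProbabilityMeasure (μ.comap (Subtype.val : 𝒵 → S)) := by
  refine ⟨?_⟩
  rw [comap_subtype_coe_apply h𝒵, Set.image_univ, Subtype.range_coe]
  exact (prob_compl_eq_zero_iff h𝒵).1 hμ

theorem integral_comap_subtypeVal (h𝒵 : MeasurableSet 𝒵) {μ : Measure S} (hμ : μ 𝒵ᶜ = 0)
    {f : S → ℝ} {g : 𝒵 → ℝ} (hfg : ∀ x : 𝒵, f x = g x) :
    ∫ x, g x ∂(μ.comap (Subtype.val : 𝒵 → S)) = ∫ x, f x ∂μ := by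
  simp_rw [← hfg]
  rw [integral_subtype_comap h𝒵, Measure.restrict_eq_self_of_ae_mem (s := 𝒵) hμ]

variable [MetricSpace S] [BorelSpace S] {F : Set (𝒵 → ℝ)} {μ ν : ℕ → Measure S}

theorem IsControlled.tendsto_ipmOn (h𝒵 : IsCompact 𝒵) (hF : IsControlled F)
    (hμ : ∀ᶠ n in atTop, IsProbabilityMeasure (μ n) ∧ μ n 𝒵ᶜ = 0)
    (hν : ∀ᶠ n in atTop, IsProbabilityMeasure (ν n) ∧ ν n 𝒵ᶜ = 0)
    (h : ∀ g : BoundedContinuousFunction S ℝ,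
      Tendsto (fun n => (∫ x, g x ∂μ n) - ∫ x, g x ∂ν n) atTop (𝓝 0)) :
    Tendsto (fun n => ipmOn 𝒵 F (μ n) (ν n)) atTop (𝓝 0) := by
  have : CompactSpace 𝒵 := isCompact_iff_compactSpace.1 h𝒵
  have hm := h𝒵.measurableSet
  refine hF.tendsto_ipm (hμ.mono fun n hn => have := hn.1
    isProbabilityMeasure_comap_subtypeVal hm hn.2) (hν.mono fun n hn => have := hn.1
    isProbabilityMeasure_comap_subtypeVal hm hn.2) fun g hg => ?_
  obtain ⟨f, hf⟩ := exists_boundedContinuousFunction_eqOn h𝒵 ⟨g, hg⟩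
  refine (h f).congr' ?_
  filter_upwards [hμ, hν] with n h1 h2
  rw [integral_comap_subtypeVal (g := g) hm h1.2 hf, integral_comap_subtypeVal (g := g) hm h2.2 hf]

theorem IsControlled.tendsto_integral_sub_of_ipmOn (h𝒵 : IsCompact 𝒵) (hF : IsControlled F)
    (hμ : ∀ᶠ n in atTop, IsProbabilityMeasure (μ n) ∧ μ n 𝒵ᶜ = 0)
    (hν : ∀ᶠ n in atTop, IsProbabilityMeasure (ν n) ∧ ν n 𝒵ᶜ = 0)
    (h : Tendsto (fun n => ipmOn 𝒵 F (μ n) (ν n)) atTop (𝓝 0))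
    (g : BoundedContinuousFunction S ℝ) :
    Tendsto (fun n => (∫ x, g x ∂μ n) - ∫ x, g x ∂ν n) atTop (𝓝 0) := by
  have : CompactSpace 𝒵 := isCompact_iff_compactSpace.1 h𝒵
  have hm := h𝒵.measurableSet
  have key := hF.tendsto_integral_sub (hμ.mono fun n hn => have := hn.1
    isProbabilityMeasure_comap_subtypeVal hm hn.2) (hν.mono fun n hn => have := hn.1
    isProbabilityMeasure_comap_subtypeVal hm hn.2) h (g := fun x : 𝒵 => g x) (by fun_prop)
  refine key.congr' ?_
  filter_upwards [hμ, hν] with n h1 h2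
  rw [integral_comap_subtypeVal hm h1.2 fun _ => rfl, integral_comap_subtypeVal hm h2.2 fun _ => rfl]

end Ambient

/-! ### Laws of i.i.d. samples -/

section Sampling

variable {Ω : Type*} [MeasurableSpace Ω] {μ : Measure Ω}
  {S : Type*} [MeasurableSpace S] {P : Measure S} {D : ℕ → Ω → S}

theorem ae_tendsto_average (hlaw : ∀ i, HasLaw (D i) P μ) (hindep : iIndepFun D μ) {f : S → ℝ}
    (hf : Measurable f) (hfi : Integrable f P) :
    ∀ᵐ ω ∂μ, Tendsto (fun n : ℕ => ∑ i : Fin n, (n : ℝ)⁻¹ * f (D i ω)) atTop (𝓝 (∫ s, f s ∂P)) := by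
  have hid : ∀ i, IdentDistrib (D i) (D 0) μ μ := fun i =>
    ⟨(hlaw i).aemeasurable, (hlaw 0).aemeasurable, (hlaw i).map_eq.trans (hlaw 0).map_eq.symm⟩
  have hint : ∫ ω, f (D 0 ω) ∂μ = ∫ s, f s ∂P := by
    rw [← (hlaw 0).map_eq, integral_map (hlaw 0).aemeasurable hf.aestronglyMeasurable]
  have h0 : Integrable (fun ω => f (D 0 ω)) μ := by
    rw [← (hlaw 0).map_eq] at hfi
    exact hfi.comp_aemeasurable (hlaw 0).aemeasurable
  have key := strong_law_ae_real (fun i ω => f (D i ω)) h0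
    (fun i j hij => (hindep.indepFun hij).comp hf hf) fun i => (hid i).comp hf
  filter_upwards [key] with ω hω
  rw [hint] at hω
  refine hω.congr fun n => ?_
  rw [← Finset.mul_sum, Finset.sum_range, div_eq_inv_mul]

theorem map_fin_eq_pi [IsProbabilityMeasure μ] (hlaw : ∀ i, HasLaw (D i) P μ) (hindep : iIndepFun D μ) (n : ℕ) :
    μ.map (fun ω (i : Fin n) => D i ω) = Measure.pi fun _ : Fin n => P := by
  have h1 : iIndepFun (fun i : Fin n => D i) μ := hindep.precomp Fin.val_injective
  rw [(iIndepFun_iff_map_fun_eq_pi_map fun i => (hlaw _).aemeasurable).1 h1]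
  simp_rw [(hlaw _).map_eq]

end Sampling

/-! ### Conditioning on the covariates and Hoeffding's inequality -/

section Disintegration

variable {A B : Type*} [MeasurableSpace A] [MeasurableSpace B]

/-- The product of the kernels `κ (z i)`, as a kernel in `z`. -/
noncomputable def piKernel (κ : Kernel A B) [IsMarkovKernel κ] (n : ℕ) :
    Kernel (Fin n → A) (Fin n → B) where
  toFun z := Measure.pi fun i => κ (z i)
  measurable' := by
    refine Measurable.measure_of_isPiSystem_of_isProbabilityMeasure generateFrom_pi.symm
      isPiSystem_pi ?_
    rintro _ ⟨s, hs, rfl⟩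
    simp only [Measure.pi_pi]
    exact Finset.measurable_prod _ fun i _ =>
      (κ.measurable_coe (hs i (Set.mem_univ i))).comp (measurable_pi_apply i)

theorem piKernel_apply (κ : Kernel A B) [IsMarkovKernel κ] (n : ℕ) (z : Fin n → A) :
    piKernel κ n z = Measure.pi fun i => κ (z i) := rfl

instance (κ : Kernel A B) [IsMarkovKernel κ] (n : ℕ) : IsMarkovKernel (piKernel κ n) :=
  ⟨fun z => by rw [piKernel_apply]; infer_instance⟩

/-- The sample can be drawn by taking all first components, then independent second components given
them. This turns weights that depend on all covariates into constants. Both laws agree on boxes,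
where the integral factorizes by independence. -/
theorem pi_compProd_eq_map (ν : Measure A) [IsProbabilityMeasure ν] (κ : Kernel A B)
    [IsMarkovKernel κ] (n : ℕ) :
    (Measure.pi fun _ : Fin n => ν ⊗ₘ κ) =
      ((Measure.pi fun _ : Fin n => ν) ⊗ₘ piKernel κ n).map fun p i => (p.1 i, p.2 i) := by
  refine Measure.pi_eq fun s hs => ?_
  have hmeas : Measurable fun (p : (Fin n → A) × (Fin n → B)) (i : Fin n) => (p.1 i, p.2 i) := by
    fun_prop
  have hκ : ∀ i, Measurable fun a => κ a (Prod.mk a ⁻¹' s i) := fun i =>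
    Kernel.measurable_kernel_prodMk_left (hs i)
  rw [Measure.map_apply hmeas (.univ_pi hs), Measure.compProd_apply (hmeas (.univ_pi hs))]
  have h1 : ∀ z : Fin n → A, piKernel κ n z (Prod.mk z ⁻¹'
      ((fun (p : (Fin n → A) × (Fin n → B)) i => (p.1 i, p.2 i)) ⁻¹' Set.univ.pi s)) =
      ∏ i, κ (z i) (Prod.mk (z i) ⁻¹' s i) := by
    intro z
    rw [piKernel_apply, ← Measure.pi_pi]
    congr 1
  simp_rw [h1]
  rw [lintegral_prod_eq_prod_lintegral_of_indepFun Finset.univ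
    (fun i (z : Fin n → A) => κ (z i) (Prod.mk (z i) ⁻¹' s i))
    (iIndepFun_pi fun i => (hκ i).aemeasurable) fun i => (hκ i).comp (measurable_pi_apply i)]
  refine Finset.prod_congr rfl fun i _ => ?_
  rw [Measure.compProd_apply (hs i)]
  exact (measurePreserving_eval (fun _ : Fin n => ν) i).lintegral_comp (hκ i)

/-- Hoeffding's inequality for weighted sums, conditionally on the first components. -/
theorem pi_measure_weighted_sum_ge_le (ν : Measure A) [IsProbabilityMeasure ν] (κ : Kernel A B)
    [IsMarkovKernel κ] {n : ℕ} {h : A × B → ℝ} (hh : Measurable h) {C : ℝ}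
    (hC : ∀ p, |h p| ≤ C) {w : (Fin n → A) → Fin n → ℝ} (hw : Measurable w) {W : ℝ}
    (hwW : ∀ z i, |w z i| ≤ W / n) {ε : ℝ} (hε : 0 ≤ ε) :
    (Measure.pi fun _ : Fin n => ν ⊗ₘ κ) {d | ε ≤ ∑ i, w (fun j => (d j).1) i *
        (h (d i) - ∫ y, h ((d i).1, y) ∂κ (d i).1)} ≤
      ENNReal.ofReal (Real.exp (-(ε ^ 2 / (2 * (W * C) ^ 2)) * n)) := by
  have hm : Measurable fun a => ∫ y, h (a, y) ∂κ a :=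
    (StronglyMeasurable.integral_kernel_prod_right' (κ := κ) hh.stronglyMeasurable).measurable
  have hset : MeasurableSet {d : Fin n → A × B | ε ≤ ∑ i, w (fun j => (d j).1) i *
        (h (d i) - ∫ y, h ((d i).1, y) ∂κ (d i).1)} := by
    refine measurableSet_le measurable_const (Finset.measurable_sum _ fun i _ => ?_)
    have h1 : Measurable fun d : Fin n → A × B => w (fun j => (d j).1) i :=
      (measurable_pi_apply i).comp (hw.comp (by fun_prop))
    have h2 : Measurable fun d : Fin n → A × B => ∫ y, h ((d i).1, y) ∂κ (d i).1 :=
      hm.comp (by fun_prop : Measurable fun d : Fin n → A × B => (d i).1)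
    fun_prop
  have hmeas : Measurable fun (p : (Fin n → A) × (Fin n → B)) (i : Fin n) => (p.1 i, p.2 i) := by
    fun_prop
  rw [pi_compProd_eq_map, Measure.map_apply hmeas hset, Measure.compProd_apply (hmeas hset)]
  refine (lintegral_mono (g := fun _ =>
    ENNReal.ofReal (Real.exp (-(ε ^ 2 / (2 * (W * C) ^ 2)) * n))) fun z => ?_).trans (by simp)
  rw [piKernel_apply]
  have hind := iIndepFun_pi (μ := fun i => κ (z i))
    (X := fun i y => w z i * h (z i, y) - ∫ y', w z i * h (z i, y') ∂κ (z i))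
    fun i => (by fun_prop : Measurable _).aemeasurable
  -- Each term lies in an interval of half-length `W / n * C`, which is its sub-Gaussian scale. The
  -- parameters add up to `(W * C) ^ 2 / n`, so the exponent is linear in `n`.
  have hsub : ∀ i ∈ Finset.univ, HasSubgaussianMGF
      (fun y : Fin n → B => w z i * h (z i, y i) - ∫ y', w z i * h (z i, y') ∂κ (z i))
      ((‖W / n * C - -(W / n * C)‖₊ / 2) ^ 2) (Measure.pi fun i => κ (z i)) := by
    intro i _
    have h1 := hasSubgaussianMGF_of_mem_Icc (μ := Measure.pi fun i => κ (z i))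
      (X := fun y : Fin n → B => w z i * h (z i, y i)) (a := -(W / n * C)) (b := W / n * C)
      (by fun_prop : Measurable _).aemeasurable (ae_of_all _ fun y => by
        rw [Set.mem_Icc, ← abs_le, abs_mul]
        exact mul_le_mul (hwW z i) (hC _) (abs_nonneg _) ((abs_nonneg _).trans (hwW z i)))
    rwa [integral_comp_eval (μ := fun i => κ (z i)) (i := i) (f := fun y => w z i * h (z i, y))
      (by fun_prop : Measurable _).aestronglyMeasurable] at h1
  have key := HasSubgaussianMGF.measure_sum_ge_le_of_iIndepFun hind hsub hε
  have hconst : ((∑ i : Fin n, (‖W / n * C - -(W / n * C)‖₊ / 2) ^ 2 : NNReal) : ℝ) =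
      n * (W / n * C) ^ 2 := by
    push_cast
    rw [Finset.sum_const, Finset.card_univ, Fintype.card_fin, nsmul_eq_mul, sub_neg_eq_add,
      ← two_mul, norm_mul, Real.norm_ofNat, mul_div_cancel_left₀ _ two_ne_zero, Real.norm_eq_abs,
      sq_abs]
  rw [← ofReal_measureReal]
  refine ENNReal.ofReal_le_ofReal ?_
  have hexp : -ε ^ 2 / (2 * ((∑ i : Fin n, (‖W / n * C - -(W / n * C)‖₊ / 2) ^ 2 : NNReal) : ℝ)) =
      -(ε ^ 2 / (2 * (W * C) ^ 2)) * n := by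
    rw [hconst]
    rcases Nat.eq_zero_or_pos n with rfl | hn
    · simp
    · have : (n : ℝ) ≠ 0 := by positivity
      have e : (n : ℝ) * (W / n * C) ^ 2 = (W * C) ^ 2 / n := by field_simp
      rw [e, mul_div_assoc', div_div_eq_mul_div]
      ring
  rw [← hexp]
  refine le_trans (le_of_eq ?_) (key.trans (le_of_eq (by push_cast; rfl)))
  congr 1
  ext y
  simp only [Set.mem_preimage, Set.mem_ofPred_eq, mul_sub, integral_const_mul]

end Disintegration

/-! ### A conditional law of large numbers -/

section ConditionalLLN

variable {Ω : Type*} [MeasurableSpace Ω] {μ : Measure Ω} [IsProbabilityMeasure μ]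
  {A B : Type*} [MeasurableSpace A] [MeasurableSpace B] [StandardBorelSpace B] [Nonempty B]
  {P : Measure (A × B)} [IsProbabilityMeasure P] {D : ℕ → Ω → A × B}

/-- Borel–Cantelli: the Hoeffding bounds decay geometrically in `n`. The lower tail follows by
applying this to `-h`. -/
theorem ae_eventually_weighted_sum_lt (hlaw : ∀ i, HasLaw (D i) P μ) (hindep : iIndepFun D μ)
    {h : A × B → ℝ} (hh : Measurable h) {C : ℝ} (hC : ∀ p, |h p| ≤ C)
    {w : ∀ n : ℕ, (Fin n → A) → Fin n → ℝ} (hw : ∀ n, Measurable (w n)) {W : ℝ}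
    (hwW : ∀ n z i, |w n z i| ≤ W / n) {ε : ℝ} (hε : 0 < ε) :
    ∀ᵐ ω ∂μ, ∀ᶠ n : ℕ in atTop, ∑ i : Fin n, w n (fun j => (D j ω).1) i *
      (h (D i ω) - ∫ y, h ((D i ω).1, y) ∂P.condKernel (D i ω).1) < ε := by
  have hbound : ∀ n : ℕ, μ {ω | ε ≤ ∑ i : Fin n, w n (fun j => (D j ω).1) i *
      (h (D i ω) - ∫ y, h ((D i ω).1, y) ∂P.condKernel (D i ω).1)} ≤
      ENNReal.ofReal (Real.exp (-(ε ^ 2 / (2 * ((|W| + 1) * (|C| + 1)) ^ 2)) * n)) := by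
    intro n
    -- Enlarging the bounds to `|W| + 1` and `|C| + 1` makes the denominator in the exponent
    -- positive, as summability requires.
    have h1 := pi_measure_weighted_sum_ge_le P.fst P.condKernel (n := n) hh (C := |C| + 1)
      (fun p => (hC p).trans ((le_abs_self C).trans (by simp))) (hw n) (W := |W| + 1)
      (fun z i => (hwW n z i).trans (by gcongr; exact (le_abs_self W).trans (by simp))) hε.le
    rw [P.disintegrate, ← map_fin_eq_pi hlaw hindep n] at h1
    refine le_trans ?_ h1
    exact Measure.le_map_apply (f := fun ω (i : Fin n) => D i ω)
      (aemeasurable_pi_lambda _ fun i => (hlaw i).aemeasurable) _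
  have hsum : ∑' n : ℕ, μ {ω | ε ≤ ∑ i : Fin n, w n (fun j => (D j ω).1) i *
      (h (D i ω) - ∫ y, h ((D i ω).1, y) ∂P.condKernel (D i ω).1)} ≠ ∞ := by
    refine ne_top_of_le_ne_top ?_ (ENNReal.tsum_le_tsum hbound)
    have hs : Summable fun n : ℕ =>
        Real.exp (-(ε ^ 2 / (2 * ((|W| + 1) * (|C| + 1)) ^ 2)) * n) := by
      simp_rw [mul_comm _ ((_ : ℕ) : ℝ)]
      exact Real.summable_exp_nat_mul_iff.2 (by rw [neg_lt_zero]; positivity)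
    rw [← ENNReal.ofReal_tsum_of_nonneg (fun _ => (Real.exp_pos _).le) hs]
    exact ENNReal.ofReal_ne_top
  filter_upwards [ae_eventually_notMem hsum] with ω hω
  filter_upwards [hω] with n hn
  simpa using hn

/-- A weighted law of large numbers for the outcomes, conditionally on the covariates: the weights
may depend on all the covariates. -/
theorem ae_tendsto_weighted_sum_sub (hlaw : ∀ i, HasLaw (D i) P μ) (hindep : iIndepFun D μ)
    {h : A × B → ℝ} (hh : Measurable h) {C : ℝ} (hC : ∀ p, |h p| ≤ C)
    {w : ∀ n : ℕ, (Fin n → A) → Fin n → ℝ} (hw : ∀ n, Measurable (w n)) {W : ℝ}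
    (hwW : ∀ n z i, |w n z i| ≤ W / n) :
    ∀ᵐ ω ∂μ, Tendsto (fun n : ℕ => ∑ i : Fin n, w n (fun j => (D j ω).1) i *
      (h (D i ω) - ∫ y, h ((D i ω).1, y) ∂P.condKernel (D i ω).1)) atTop (𝓝 0) := by
  have h1 : ∀ᵐ ω ∂μ, ∀ k : ℕ, ∀ᶠ n : ℕ in atTop, ∑ i : Fin n, w n (fun j => (D j ω).1) i *
      (h (D i ω) - ∫ y, h ((D i ω).1, y) ∂P.condKernel (D i ω).1) < 1 / ((k : ℝ) + 1) :=
    ae_all_iff.2 fun k =>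
      ae_eventually_weighted_sum_lt hlaw hindep hh hC hw hwW (by positivity)
  have h2 : ∀ᵐ ω ∂μ, ∀ k : ℕ, ∀ᶠ n : ℕ in atTop, ∑ i : Fin n, w n (fun j => (D j ω).1) i *
      (-h (D i ω) - ∫ y, -h ((D i ω).1, y) ∂P.condKernel (D i ω).1) < 1 / ((k : ℝ) + 1) :=
    ae_all_iff.2 fun k => ae_eventually_weighted_sum_lt (h := fun p => -h p) (C := C) hlaw hindep
      hh.neg (fun p => by rw [abs_neg]; exact hC p) hw hwW (by positivity)
  filter_upwards [h1, h2] with ω h1 h2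
  rw [Metric.tendsto_nhds]
  intro ε hε
  obtain ⟨k, hk⟩ := exists_nat_one_div_lt hε
  filter_upwards [h1 k, h2 k] with n h1 h2
  simp only [integral_neg] at h2
  have e : ∑ i : Fin n, w n (fun j => (D j ω).1) i *
      (-h (D i ω) - -∫ y, h ((D i ω).1, y) ∂P.condKernel (D i ω).1) =
      -∑ i : Fin n, w n (fun j => (D j ω).1) i *
      (h (D i ω) - ∫ y, h ((D i ω).1, y) ∂P.condKernel (D i ω).1) := by
    rw [← Finset.sum_neg_distrib]
    exact Finset.sum_congr rfl fun i _ => by ring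
  rw [e] at h2
  rw [Real.dist_eq, sub_zero, abs_lt]
  constructor <;> linarith

end ConditionalLLN

/-! ### Weighted empirical measures -/

section WeightedEmpirical

variable {S : Type*} [MeasurableSpace S] {n : ℕ} {w : Fin n → ℝ} {s : Fin n → S}

theorem coe_weightedEmpirical (w : Fin n → ℝ) (s : Fin n → S) :
    (weightedEmpirical w s : Measure S) = ∑ i, ENNReal.ofReal (w i) • Measure.dirac (s i) := rfl

theorem integral_weightedEmpirical [MeasurableSingletonClass S] (hw : ∀ i, 0 ≤ w i) (f : S → ℝ) :
    ∫ x, f x ∂(weightedEmpirical w s : Measure S) = ∑ i, w i * f (s i) := by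
  rw [coe_weightedEmpirical, integral_finsetSum_measure fun i _ =>
    (integrable_dirac (by simp)).smul_measure ENNReal.ofReal_ne_top]
  refine Finset.sum_congr rfl fun i _ => ?_
  rw [integral_smul_measure, integral_dirac, ENNReal.toReal_ofReal (hw i), smul_eq_mul]

theorem weightedEmpirical_compl_eq_zero {K : Set S} (hK : MeasurableSet K) (hs : ∀ i, s i ∈ K) :
    (weightedEmpirical w s : Measure S) Kᶜ = 0 := by
  simp [coe_weightedEmpirical, Measure.dirac_apply' _ hK.compl, hs]

theorem weightedEmpirical_real_univ (hw : ∀ i, 0 ≤ w i) :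
    (weightedEmpirical w s : Measure S).real Set.univ = ∑ i, w i := by
  rw [measureReal_def, coe_weightedEmpirical]
  simp only [Measure.coe_finsetSum, Measure.coe_smul, Finset.sum_apply, Pi.smul_apply,
    measure_univ, smul_eq_mul, mul_one]
  rw [ENNReal.toReal_sum fun i _ => ENNReal.ofReal_ne_top]
  exact Finset.sum_congr rfl fun i _ => ENNReal.toReal_ofReal (hw i)

theorem isProbabilityMeasure_weightedEmpirical (hw : w ∈ stdSimplex ℝ (Fin n)) :
    IsProbabilityMeasure (weightedEmpirical w s : Measure S) := by
  refine ⟨?_⟩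
  have h := weightedEmpirical_real_univ (s := s) hw.1
  rw [hw.2, measureReal_def, ENNReal.toReal_eq_one_iff] at h
  exact h

theorem isProbabilityMeasure_empirical (hn : n ≠ 0) :
    IsProbabilityMeasure (empirical s : Measure S) :=
  isProbabilityMeasure_weightedEmpirical ⟨fun _ => by positivity, by simp [hn]⟩

/-- Almost sure weak convergence of weighted empirical distributions whose `i`-th weight is a
bounded function of the `i`-th observation. -/
theorem ae_tendsto_weightedEmpirical {Ω : Type*} [MeasurableSpace Ω] {μ : Measure Ω}
    {P : Measure S} [IsProbabilityMeasure P] {D : ℕ → Ω → S} (hlaw : ∀ i, HasLaw (D i) P μ)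
    (hindep : iIndepFun D μ) {S' : Type*} [MetricSpace S'] [MeasurableSpace S'] [BorelSpace S']
    {φ : S → S'} (hφ : Measurable φ) {K : Set S'} (hK : IsCompact K)
    (hDK : ∀ᵐ ω ∂μ, ∀ i, φ (D i ω) ∈ K) {r : S → ℝ} (hr : Measurable r) (hr0 : ∀ s, 0 ≤ r s)
    {R : ℝ} (hrR : ∀ s, r s ≤ R) (ν : FiniteMeasure S') (hνK : (ν : Measure S') Kᶜ = 0)
    (hν : ∀ g : BoundedContinuousFunction S' ℝ,
      ∫ x, g x ∂(ν : Measure S') = ∫ s, r s * g (φ s) ∂P) :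
    ∀ᵐ ω ∂μ, Tendsto (fun n : ℕ => weightedEmpirical (fun i : Fin n => (n : ℝ)⁻¹ * r (D i ω))
      fun i => φ (D i ω)) atTop (𝓝 ν) := by
  obtain ⟨g, hg⟩ := exists_seq_forall_tendsto hK
  have hint : ∀ k, Integrable (fun s => r s * g k (φ s)) P := fun k => by
    refine Integrable.of_bound (C := R * ‖g k‖)
      (hr.mul ((g k).continuous.measurable.comp hφ)).aestronglyMeasurable (ae_of_all _ fun s => ?_)
    rw [norm_mul, Real.norm_of_nonneg (hr0 s)]
    exact mul_le_mul (hrR s) ((g k).norm_coe_le_norm _) (norm_nonneg _) ((hr0 s).trans (hrR s))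
  have hlim : ∀ᵐ ω ∂μ, ∀ k, Tendsto (fun n : ℕ => ∑ i : Fin n,
      (n : ℝ)⁻¹ * (r (D i ω) * g k (φ (D i ω)))) atTop (𝓝 (∫ s, r s * g k (φ s) ∂P)) :=
    ae_all_iff.2 fun k => ae_tendsto_average hlaw hindep
      (hr.mul ((g k).continuous.measurable.comp hφ)) (hint k)
  filter_upwards [hDK, hlim] with ω h1 h2
  have hw0 : ∀ (n : ℕ) (i : Fin n), 0 ≤ (n : ℝ)⁻¹ * r (D i ω) := fun n i =>
    mul_nonneg (by positivity) (hr0 _)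
  refine hg _ ν R (Eventually.of_forall fun n =>
    weightedEmpirical_compl_eq_zero hK.measurableSet fun i => h1 i) hνK ?_ fun k => ?_
  · filter_upwards [eventually_ne_atTop 0] with n hn
    rw [weightedEmpirical_real_univ (hw0 n)]
    calc ∑ i : Fin n, (n : ℝ)⁻¹ * r (D i ω) ≤ ∑ i : Fin n, (n : ℝ)⁻¹ * R := by
          gcongr; exact hrR _
      _ = R := by
        rw [Finset.sum_const, Finset.card_univ, Fintype.card_fin, nsmul_eq_mul]
        field_simp
  · rw [hν]
    refine (h2 k).congr fun n => ?_
    rw [integral_weightedEmpirical (hw0 n)]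
    exact Finset.sum_congr rfl fun i _ => by ring

end WeightedEmpirical

theorem tendsto_integral_prod {A B : Type*} [MetricSpace A] [MeasurableSpace A] [BorelSpace A]
    [SecondCountableTopology A] [MetricSpace B] [MeasurableSpace B] [BorelSpace B]
    [SecondCountableTopology B] {α : ℕ → FiniteMeasure A} {β : ℕ → FiniteMeasure B}
    {α' : ProbabilityMeasure A} {β' : ProbabilityMeasure B}
    (hα : ∀ᶠ n in atTop, IsProbabilityMeasure (α n : Measure A))
    (hβ : ∀ᶠ n in atTop, IsProbabilityMeasure (β n : Measure B))
    (hα' : Tendsto α atTop (𝓝 α'.toFiniteMeasure)) (hβ' : Tendsto β atTop (𝓝 β'.toFiniteMeasure))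
    (g : BoundedContinuousFunction (A × B) ℝ) :
    Tendsto (fun n => ∫ x, g x ∂((α n : Measure A).prod (β n : Measure B))) atTop
      (𝓝 (∫ x, g x ∂((α' : Measure A).prod (β' : Measure B)))) := by
  classical
  -- The limit is a dummy value at the indices where `α n` is not a probability measure, such as `n
  -- = 0` for empirical measures.
  let a : ℕ → ProbabilityMeasure A := fun n =>
    if h : IsProbabilityMeasure (α n : Measure A) then ⟨α n, h⟩ else α'
  let b : ℕ → ProbabilityMeasure B := fun n =>
    if h : IsProbabilityMeasure (β n : Measure B) then ⟨β n, h⟩ else β'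
  have ha : ∀ᶠ n in atTop, α n = (a n).toFiniteMeasure := by
    filter_upwards [hα] with n hn
    have : a n = ⟨α n, hn⟩ := dif_pos hn
    rw [this]
    rfl
  have hb : ∀ᶠ n in atTop, β n = (b n).toFiniteMeasure := by
    filter_upwards [hβ] with n hn
    have : b n = ⟨β n, hn⟩ := dif_pos hn
    rw [this]
    rfl
  have hat : Tendsto a atTop (𝓝 α') :=
    (ProbabilityMeasure.tendsto_nhds_iff_toFiniteMeasure_tendsto_nhds _).2 (hα'.congr' ha)
  have hbt : Tendsto b atTop (𝓝 β') :=
    (ProbabilityMeasure.tendsto_nhds_iff_toFiniteMeasure_tendsto_nhds _).2 (hβ'.congr' hb)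
  have key := (ProbabilityMeasure.tendsto_iff_forall_integral_tendsto.1
    ((ProbabilityMeasure.continuous_prod.tendsto (α', β')).comp (hat.prodMk_nhds hbt))) g
  refine key.congr' ?_
  filter_upwards [ha, hb] with n h1 h2
  rw [h1, h2]
  rfl

/-! ### Consistency of the minimizers on the covariates -/

/-- Moves the penalty to the other side of the minimality inequality, where an IPM may a priori be
infinite. -/
theorem le_add_ofReal_of_coe_add_le {A B : ℝ≥0∞} {x y : ℝ}
    (h : (A : EReal) + (x : EReal) ≤ (B : EReal) + (y : EReal)) :
    A ≤ B + ENNReal.ofReal (y - x) := by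
  rcases eq_or_ne B ∞ with rfl | hB
  · simp
  lift B to NNReal using hB
  rcases eq_or_ne A ∞ with rfl | hA
  · rw [EReal.coe_ennreal_top, EReal.top_add_coe, top_le_iff] at h
    exact absurd h (by rw [EReal.coe_nnreal_eq_coe_real, ← EReal.coe_add]; exact EReal.coe_ne_top _)
  lift A to NNReal using hA
  rw [EReal.coe_nnreal_eq_coe_real, EReal.coe_nnreal_eq_coe_real, ← EReal.coe_add, ← EReal.coe_add,
    EReal.coe_le_coe_iff] at h
  rw [← ENNReal.ofReal_coe_nnreal (p := A), ← ENNReal.ofReal_coe_nnreal (p := B)]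
  refine le_trans (ENNReal.ofReal_le_ofReal (by linarith : (A : ℝ) ≤ B + (y - x))) ?_
  exact ENNReal.ofReal_add_le

theorem abs_regularizer_le {ρ : ℝ → ℝ} {W b : ℝ} (hρ : ∀ x ∈ Set.Icc 0 W, |ρ x| ≤ b) {n : ℕ}
    (hn : n ≠ 0) {w : Fin n → ℝ} (hw : w ∈ feasible W n) : |regularizer ρ w| ≤ b * (n : ℝ)⁻¹ := by
  have hn' : (0 : ℝ) < n := by positivity
  rw [regularizer, abs_mul, abs_of_nonneg (by positivity)]
  have h1 : |∑ i, ρ (n * w i)| ≤ n * b := by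
    refine (Finset.abs_sum_le_sum_abs _ _).trans ?_
    refine (Finset.sum_le_card_nsmul _ _ b fun i _ => hρ _ ⟨?_, ?_⟩).trans (by simp)
    · exact mul_nonneg hn'.le (hw.1.1 i)
    · have := hw.2 i
      rw [le_div_iff₀ hn'] at this
      linarith
  calc ((n : ℝ) ^ 2)⁻¹ * |∑ i, ρ (n * w i)| ≤ ((n : ℝ) ^ 2)⁻¹ * (n * b) := by gcongr
    _ = b * (n : ℝ)⁻¹ := by field_simp

theorem tendsto_zero_of_tendsto_sq {a : ℕ → ℝ≥0∞} (h : Tendsto (fun n => a n ^ 2) atTop (𝓝 0)) :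
    Tendsto a atTop (𝓝 0) := by
  rw [ENNReal.tendsto_nhds_zero] at h ⊢
  intro ε hε
  filter_upwards [h (ε ^ 2) (ENNReal.pow_pos hε 2)] with n hn
  exact (ENNReal.pow_le_pow_left_iff two_ne_zero).1 hn

/-- Deterministic consistency: if some feasible weights reproduce the target in the limit, then so
do the CBDM weights. -/
theorem tendsto_sum_of_isCBDMWeights {dT dX : ℕ} {𝒵 : Set (TX dT dX)} (h𝒵 : IsCompact 𝒵)
    {F : Set (𝒵 → ℝ)} (hF : IsControlled F) {ρ : ℝ → ℝ} {W lam : ℝ}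
    (hρ : ContinuousOn ρ (Set.Icc 0 W)) (hlam : 0 ≤ lam) {z : ℕ → TX dT dX} (hz : ∀ i, z i ∈ 𝒵)
    {Q : Measure (TX dT dX)}
    (hprod : ∀ᶠ n : ℕ in atTop, IsProbabilityMeasure (productEmpirical fun i : Fin n => z i) ∧
      productEmpirical (fun i : Fin n => z i) 𝒵ᶜ = 0)
    (hprodlim : ∀ g : BoundedContinuousFunction (TX dT dX) ℝ, Tendsto (fun n : ℕ =>
      ∫ x, g x ∂productEmpirical fun i : Fin n => z i) atTop (𝓝 (∫ x, g x ∂Q)))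
    {v : ∀ n : ℕ, Fin n → ℝ} (hv : ∀ᶠ n : ℕ in atTop, v n ∈ feasible W n)
    (hvlim : ∀ g : BoundedContinuousFunction (TX dT dX) ℝ, Tendsto (fun n : ℕ =>
      ∑ i : Fin n, v n i * g (z i)) atTop (𝓝 (∫ x, g x ∂Q)))
    {w : ∀ n : ℕ, Fin n → ℝ}
    (hw : ∀ᶠ n : ℕ in atTop, IsCBDMWeights 𝒵 F ρ lam W (fun i : Fin n => z i) (w n))
    (g : BoundedContinuousFunction (TX dT dX) ℝ) :
    Tendsto (fun n : ℕ => ∑ i : Fin n, w n i * g (z i)) atTop (𝓝 (∫ x, g x ∂Q)) := by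
  obtain ⟨b, hb⟩ := isCompact_Icc.exists_bound_of_continuousOn hρ
  have hcarr : ∀ {u : ∀ n : ℕ, Fin n → ℝ}, (∀ᶠ n : ℕ in atTop, u n ∈ feasible W n) →
      ∀ᶠ n : ℕ in atTop, IsProbabilityMeasure
        (weightedEmpirical (u n) (fun i : Fin n => z i) : Measure (TX dT dX)) ∧
        (weightedEmpirical (u n) (fun i : Fin n => z i) : Measure (TX dT dX)) 𝒵ᶜ = 0 := fun hu =>
    hu.mono fun n hn => ⟨isProbabilityMeasure_weightedEmpirical hn.1,
      weightedEmpirical_compl_eq_zero h𝒵.measurableSet fun i => hz i⟩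
  have hint : ∀ {u : ∀ n : ℕ, Fin n → ℝ}, (∀ᶠ n : ℕ in atTop, u n ∈ feasible W n) →
      ∀ g : BoundedContinuousFunction (TX dT dX) ℝ,
      (fun n : ℕ => ∫ x, g x ∂(weightedEmpirical (u n) (fun i : Fin n => z i) : Measure (TX dT dX)))
        =ᶠ[atTop] fun n => ∑ i : Fin n, u n i * g (z i) := fun hu g =>
    hu.mono fun n hn => integral_weightedEmpirical hn.1.1 _
  have hwf : ∀ᶠ n : ℕ in atTop, w n ∈ feasible W n := hw.mono fun n hn => hn.1
  have hipmv : Tendsto (fun n : ℕ => ipmOn 𝒵 F (weightedEmpirical (v n) fun i : Fin n => z i)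
      (productEmpirical fun i : Fin n => z i)) atTop (𝓝 0) := by
    refine hF.tendsto_ipmOn h𝒵 (hcarr hv) hprod fun g => ?_
    rw [← sub_self (∫ x, g x ∂Q)]
    exact ((hvlim g).congr' (hint hv g).symm).sub (hprodlim g)
  have hipmw : Tendsto (fun n : ℕ => ipmOn 𝒵 F (weightedEmpirical (w n) fun i : Fin n => z i)
      (productEmpirical fun i : Fin n => z i)) atTop (𝓝 0) := by
    refine tendsto_zero_of_tendsto_sq ?_
    -- Minimality bounds the squared IPM of `w n` by that of the competitor `v n` plus the
    -- difference of the penalties, at most `2 * lam * b / n`.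
    have hbd : Tendsto (fun n : ℕ => ipmOn 𝒵 F (weightedEmpirical (v n) fun i : Fin n => z i)
        (productEmpirical fun i : Fin n => z i) ^ 2 + ENNReal.ofReal (2 * lam * b * (n : ℝ)⁻¹))
        atTop (𝓝 0) := by
      have h1 : Tendsto (fun n : ℕ => ENNReal.ofReal (2 * lam * b * (n : ℝ)⁻¹)) atTop (𝓝 0) := by
        rw [← ENNReal.ofReal_zero, ← mul_zero (2 * lam * b)]
        exact ENNReal.tendsto_ofReal (tendsto_inv_atTop_nhds_zero_nat.const_mul _)
      simpa using (ENNReal.Tendsto.pow (n := 2) hipmv).add h1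
    refine tendsto_of_tendsto_of_tendsto_of_le_of_le' tendsto_const_nhds hbd
      (Eventually.of_forall fun _ => zero_le) ?_
    filter_upwards [hv, hw, eventually_ne_atTop 0] with n h1 h2 hn
    refine (le_add_ofReal_of_coe_add_le (h2.2 h1)).trans ?_
    gcongr
    have h3 := abs_le.1 (abs_regularizer_le hb hn h1)
    have h4 := abs_le.1 (abs_regularizer_le hb hn h2.1)
    have h5 : lam * (regularizer ρ (v n) - regularizer ρ (w n)) ≤
        lam * (2 * (b * (n : ℝ)⁻¹)) := by
      gcongr; linarith [h3.2, h4.1]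
    linarith
  have key := (hF.tendsto_integral_sub_of_ipmOn h𝒵 (hcarr hwf) hprod hipmw g).add (hprodlim g)
  simp only [sub_add_cancel, zero_add] at key
  exact key.congr' (hint hwf g)

/-- Weights of order `1 / n` which integrate bounded continuous functions correctly in the limit
also integrate bounded measurable functions correctly. -/
theorem ae_tendsto_sum_of_measurable {Ω : Type*} [MeasurableSpace Ω] {μ : Measure Ω}
    {S : Type*} [MetricSpace S] [MeasurableSpace S] [BorelSpace S] {P : Measure S}
    [IsProbabilityMeasure P] {Z : ℕ → Ω → S} (hlaw : ∀ i, HasLaw (Z i) P μ)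
    (hindep : iIndepFun Z μ) {Q : Measure S} [IsProbabilityMeasure Q] {W₀ : ℝ} (hW₀ : 0 ≤ W₀)
    (hQ : Q ≤ ENNReal.ofReal W₀ • P) {m : S → ℝ} (hm : Measurable m) {C : ℝ}
    (hC : ∀ s, |m s| ≤ C) {W : ℝ} (hW : 0 ≤ W) {w : ∀ n : ℕ, Ω → Fin n → ℝ}
    (hw : ∀ᵐ ω ∂μ, ∀ᶠ n : ℕ in atTop, ∀ i, |w n ω i| ≤ W / n)
    (hlim : ∀ᵐ ω ∂μ, ∀ g : BoundedContinuousFunction S ℝ,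
      Tendsto (fun n : ℕ => ∑ i : Fin n, w n ω i * g (Z i ω)) atTop (𝓝 (∫ x, g x ∂Q))) :
    ∀ᵐ ω ∂μ, Tendsto (fun n : ℕ => ∑ i : Fin n, w n ω i * m (Z i ω)) atTop
      (𝓝 (∫ x, m x ∂Q)) := by
  have hmi : ∀ (κ : Measure S) [IsProbabilityMeasure κ], Integrable m κ := fun κ _ =>
    Integrable.of_bound hm.aestronglyMeasurable C (ae_of_all _ hC)
  choose g hg hgi using fun j : ℕ => (hmi P).exists_boundedContinuous_integral_sub_le
    (ε := 1 / ((j : ℝ) + 1)) (by positivity)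
  have hdi : ∀ j, Integrable (fun x => |m x - g j x|) P := fun j => ((hmi P).sub (hgi j)).abs
  have hslln : ∀ᵐ ω ∂μ, ∀ j, Tendsto (fun n : ℕ => ∑ i : Fin n,
      (n : ℝ)⁻¹ * |m (Z i ω) - g j (Z i ω)|) atTop (𝓝 (∫ x, |m x - g j x| ∂P)) :=
    ae_all_iff.2 fun j => ae_tendsto_average hlaw hindep
      (hm.sub (g j).continuous.measurable).abs (hdi j)
  filter_upwards [hw, hlim, hslln] with ω h1 h2 h3
  refine tendsto_of_forall_approx fun ε hε => ?_
  -- With `δ = 1 / (j + 1)`, the weighted sums err by at most `2 * W * δ` (the factor `2` is slack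
  -- for the strong law) and the integrals under `Q` by at most `W₀ * δ`.
  obtain ⟨j, hj⟩ := exists_nat_one_div_lt (div_pos hε (by positivity : 0 < 2 * W + W₀ + 1))
  have hpos : 0 < 1 / ((j : ℝ) + 1) := by positivity
  have hj' : (2 * W + W₀) * (1 / ((j : ℝ) + 1)) ≤ ε := by
    rw [lt_div_iff₀ (by positivity)] at hj
    linarith
  have hgj : ∫ x, |m x - g j x| ∂P ≤ 1 / ((j : ℝ) + 1) := hg j
  refine ⟨_, _, h2 (g j), ?_, ?_⟩
  · have h4 := (h3 j).eventually_le_const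
      (lt_of_le_of_lt hgj (by linarith : 1 / ((j : ℝ) + 1) < 2 * (1 / ((j : ℝ) + 1))))
    filter_upwards [h1, h4] with n h5 h6
    rw [← Finset.sum_sub_distrib]
    refine (Finset.abs_sum_le_sum_abs _ _).trans ?_
    calc ∑ i : Fin n, |w n ω i * m (Z i ω) - w n ω i * g j (Z i ω)|
        ≤ ∑ i : Fin n, W * ((n : ℝ)⁻¹ * |m (Z i ω) - g j (Z i ω)|) := by
          refine Finset.sum_le_sum fun i _ => ?_
          rw [← mul_sub, abs_mul, ← mul_assoc, ← div_eq_mul_inv]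
          exact mul_le_mul_of_nonneg_right (h5 i) (abs_nonneg _)
      _ = W * ∑ i : Fin n, (n : ℝ)⁻¹ * |m (Z i ω) - g j (Z i ω)| := by rw [Finset.mul_sum]
      _ ≤ W * (2 * (1 / ((j : ℝ) + 1))) := by gcongr
      _ ≤ ε := by
        have : 0 ≤ W₀ * (1 / ((j : ℝ) + 1)) := by positivity
        linarith
  · have hQi : Integrable (fun x => |m x - g j x|) (ENNReal.ofReal W₀ • P) :=
      (hdi j).smul_measure ENNReal.ofReal_ne_top
    rw [← integral_sub (hmi Q) ((g j).integrable Q)]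
    refine (abs_integral_le_integral_abs).trans ?_
    refine (integral_mono_measure hQ (ae_of_all _ fun _ => abs_nonneg _) hQi).trans ?_
    rw [integral_smul_measure, ENNReal.toReal_ofReal hW₀, smul_eq_mul]
    have h7 : W₀ * ∫ x, |m x - g j x| ∂P ≤ W₀ * (1 / ((j : ℝ) + 1)) := by gcongr
    have h8 : 0 ≤ W * (1 / ((j : ℝ) + 1)) := by positivity
    linarith

/-! ### Overlap, supports and the oracle weights -/

section Target

variable {dT dX : ℕ} (P : Measure (TX dT dX × ℝ)) [IsProbabilityMeasure P]

instance : IsProbabilityMeasure (targetTX P) := by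
  unfold targetTX; infer_instance

/-- Under overlap, the support of `P_T ⊗ P_X` is contained in that of `P_{T,X}`. -/
theorem support_prod_support_subset (hac : targetTX P ≪ P.fst) :
    P.fst.fst.support ×ˢ P.fst.snd.support ⊆ P.fst.support := by
  rintro ⟨t, x⟩ ⟨ht, hx⟩
  refine hac.support_mono ?_
  rw [Measure.mem_support_iff_forall] at *
  intro U hU
  obtain ⟨V, hV, V', hV', hVU⟩ := mem_nhds_prod_iff.1 hU
  refine lt_of_lt_of_le ?_ (measure_mono hVU)
  rw [targetTX, Measure.prod_prod]
  exact ENNReal.mul_pos (ht V hV).ne' (hx V' hV').ne'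

theorem ae_mem_support {S : Type*} [MetricSpace S] [SecondCountableTopology S] [MeasurableSpace S]
    {Ω : Type*} [MeasurableSpace Ω] {μ : Measure Ω} {ν : Measure S} {Z : ℕ → Ω → S}
    (hlaw : ∀ i, HasLaw (Z i) ν μ) : ∀ᵐ ω ∂μ, ∀ i, Z i ω ∈ ν.support := by
  refine ae_all_iff.2 fun i => ?_
  have h : ∀ᵐ s ∂(μ.map (Z i)), s ∈ ν.support := by
    rw [(hlaw i).map_eq]; exact Measure.support_mem_ae
  exact ae_of_ae_map (hlaw i).aemeasurable h

theorem targetTX_le_smul {W₀ : ℝ} (hac : targetTX P ≪ P.fst)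
    (hdens : ∀ᵐ z ∂P.fst, (targetTX P).rnDeriv P.fst z ≤ ENNReal.ofReal W₀) :
    targetTX P ≤ ENNReal.ofReal W₀ • P.fst := by
  rw [← withDensity_const, ← Measure.withDensity_rnDeriv_eq _ _ hac]
  exact withDensity_mono hdens

/-- A bounded version of the density of the target. -/
theorem exists_bounded_density {W₀ : ℝ} (hW₀ : 0 ≤ W₀) (hac : targetTX P ≪ P.fst)
    (hdens : ∀ᵐ z ∂P.fst, (targetTX P).rnDeriv P.fst z ≤ ENNReal.ofReal W₀) :
    ∃ r : TX dT dX → ℝ, Measurable r ∧ (∀ z, 0 ≤ r z) ∧ (∀ z, r z ≤ W₀) ∧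
      ∀ g : TX dT dX → ℝ, ∫ z, g z ∂targetTX P = ∫ z, r z * g z ∂P.fst := by
  -- Truncation turns the almost sure bound into an everywhere bound without changing any integral.
  refine ⟨fun z => min ((targetTX P).rnDeriv P.fst z).toReal W₀,
    ((Measure.measurable_rnDeriv _ _).ennreal_toReal).min measurable_const,
    fun z => le_min ENNReal.toReal_nonneg hW₀, fun z => min_le_right _ _, fun g => ?_⟩
  rw [← integral_rnDeriv_smul hac]
  refine integral_congr_ae ?_
  filter_upwards [hdens] with z hz
  rw [smul_eq_mul, min_eq_left (ENNReal.toReal_le_of_le_ofReal hW₀ hz)]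

end Target

/-- Normalized weights whose unnormalized version is bounded by `W₀ / n` with total mass tending to
one satisfy any looser clipping constraint eventually. -/
theorem eventually_normalized_mem_feasible {r : ℕ → ℝ} {W₀ W : ℝ} (hW₀ : 0 < W₀) (hW : W₀ < W)
    (hr0 : ∀ i, 0 ≤ r i) (hr : ∀ i, r i ≤ W₀)
    (h : Tendsto (fun n : ℕ => ∑ i : Fin n, (n : ℝ)⁻¹ * r i) atTop (𝓝 1)) :
    ∀ᶠ n : ℕ in atTop, (fun i : Fin n => (n : ℝ)⁻¹ * r i / ∑ j : Fin n, (n : ℝ)⁻¹ * r j) ∈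
      feasible W n := by
  have hW' : 0 < W := hW₀.trans hW
  -- Once the total mass exceeds `W₀ / W < 1`, dividing by it raises the cap `W₀ / n` to at most `W
  -- / n`.
  filter_upwards [h.eventually_const_lt ((div_lt_one hW').2 hW), eventually_ne_atTop 0] with n h1 hn
  have hn' : (0 : ℝ) < n := by positivity
  have hpos : 0 < ∑ j : Fin n, (n : ℝ)⁻¹ * r j := lt_trans (by positivity) h1
  refine ⟨⟨fun i => div_nonneg (mul_nonneg (by positivity) (hr0 i)) hpos.le, ?_⟩, fun i => ?_⟩
  · rw [← Finset.sum_div, div_self hpos.ne']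
  · rw [div_le_iff₀ hpos]
    rw [div_lt_iff₀ hW'] at h1
    calc (n : ℝ)⁻¹ * r i ≤ (n : ℝ)⁻¹ * W₀ := by gcongr; exact hr i
      _ ≤ (n : ℝ)⁻¹ * ((∑ j : Fin n, (n : ℝ)⁻¹ * r j) * W) := by gcongr
      _ = W / n * ∑ j : Fin n, (n : ℝ)⁻¹ * r j := by ring

/-- The atoms pair the treatment of one unit with the covariates of another, so they need not be
data points; the rectangle inclusion `hAB`, supplied by overlap, keeps them in `𝒵`. -/
theorem productEmpirical_carrier {dT dX : ℕ} {𝒵 : Set (TX dT dX)} (h𝒵 : MeasurableSet 𝒵)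
    {A : Set (EuclideanSpace ℝ (Fin dT))} {B : Set (EuclideanSpace ℝ (Fin dX))}
    (hA : MeasurableSet A) (hB : MeasurableSet B) (hAB : A ×ˢ B ⊆ 𝒵) {n : ℕ} (hn : n ≠ 0)
    {z : Fin n → TX dT dX} (hzA : ∀ i, (z i).1 ∈ A) (hzB : ∀ i, (z i).2 ∈ B) :
    IsProbabilityMeasure (productEmpirical z) ∧ productEmpirical z 𝒵ᶜ = 0 := by
  have h1 := isProbabilityMeasure_empirical (s := fun i => (z i).1) hn
  have h2 := isProbabilityMeasure_empirical (s := fun i => (z i).2) hn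
  have hp : IsProbabilityMeasure (productEmpirical z) := by
    unfold productEmpirical; infer_instance
  refine ⟨hp, (prob_compl_eq_zero_iff h𝒵).2 (le_antisymm prob_le_one ?_)⟩
  refine le_trans (le_of_eq ?_) (measure_mono hAB)
  have h3 : (empirical (fun i => (z i).1) : Measure _) A = 1 :=
    (prob_compl_eq_zero_iff hA).1 (weightedEmpirical_compl_eq_zero hA hzA)
  have h4 : (empirical (fun i => (z i).2) : Measure _) B = 1 :=
    (prob_compl_eq_zero_iff hB).1 (weightedEmpirical_compl_eq_zero hB hzB)
  rw [productEmpirical, Measure.prod_prod, h3, h4, one_mul]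

/-! ### Almost sure convergence -/

section Main

variable {Ω : Type*} [MeasurableSpace Ω] {μ : Measure Ω}

theorem hasLaw_comp {S S' : Type*} [MeasurableSpace S] [MeasurableSpace S'] {P : Measure S}
    {Z : Ω → S} (h : HasLaw Z P μ) {φ : S → S'} (hφ : Measurable φ) :
    HasLaw (fun ω => φ (Z ω)) (P.map φ) μ :=
  ⟨hφ.comp_aemeasurable h.aemeasurable, by
    rw [← h.map_eq, AEMeasurable.map_map_of_aemeasurable hφ.aemeasurable h.aemeasurable]
    rfl⟩

theorem isCompact_support_map {S S' : Type*} [MetricSpace S] [SecondCountableTopology S]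
    [MeasurableSpace S] [MetricSpace S'] [MeasurableSpace S'] [BorelSpace S'] {P : Measure S}
    (hP : IsCompact P.support) {φ : S → S'} (hφ : Continuous φ) (hφm : Measurable φ) :
    IsCompact (P.map φ).support := by
  refine (hP.image hφ).of_isClosed_subset Measure.isClosed_support
    (Measure.support_subset_of_isClosed (hP.image hφ).isClosed ?_)
  rw [mem_ae_map_iff hφm.aemeasurable (hP.image hφ).measurableSet]
  exact mem_of_superset Measure.support_mem_ae (Set.subset_preimage_image _ _)

/-- The empirical distributions of a coordinate of i.i.d. data converge almost surely. -/
theorem ae_tendsto_empirical {S S' : Type*} [MeasurableSpace S] [MetricSpace S']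
    [SecondCountableTopology S'] [MeasurableSpace S'] [BorelSpace S'] {P : Measure S}
    [IsProbabilityMeasure P] {D : ℕ → Ω → S} (hlaw : ∀ i, HasLaw (D i) P μ)
    (hindep : iIndepFun D μ) {φ : S → S'} (hφ : Measurable φ)
    (hK : IsCompact (P.map φ).support) (ν : ProbabilityMeasure S') (hν : (ν : Measure S') = P.map φ) :
    ∀ᵐ ω ∂μ, Tendsto (fun n : ℕ => empirical fun i : Fin n => φ (D i ω)) atTop
      (𝓝 ν.toFiniteMeasure) := by
  have hlaw' := fun i => hasLaw_comp (hlaw i) hφ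
  have key := ae_tendsto_weightedEmpirical hlaw hindep hφ hK (ae_mem_support hlaw')
    (r := fun _ => 1) measurable_const (fun _ => zero_le_one) (R := 1) (fun _ => le_rfl)
    ν.toFiniteMeasure (by
      change (ν : Measure S') _ = 0
      rw [hν]; exact Measure.measure_compl_support) fun g => by
        change ∫ x, g x ∂(ν : Measure S') = _
        rw [hν, integral_map hφ.aemeasurable g.continuous.aestronglyMeasurable]
        simp
  simp only [mul_one] at key
  exact key

theorem isControlled_of_eq_or {dT dX : ℕ} {𝒵 : Set (TX dT dX)} (h𝒵 : IsCompact 𝒵)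
    {F : Set (𝒵 → ℝ)} (hF : F = lipschitzClass 𝒵 ∨
      ∃ (K : 𝒵 → 𝒵 → ℝ) (hK : IsKernel K), IsUniversal K hK ∧ F = mmdClass K hK) :
    IsControlled F := by
  rcases hF with rfl | ⟨K, hK, hU, rfl⟩
  · exact isControlled_lipschitzClass h𝒵
  · exact isControlled_mmdClass hU

variable {dT dX : ℕ} {P : Measure (TX dT dX × ℝ)} [IsProbabilityMeasure P]

/-- Almost surely, the CBDM weighted distribution of the covariates converges weakly to
`P_T ⊗ P_X`. -/
theorem ae_tendsto_sum_covariates (h𝒵 : IsCompact P.fst.support) {Z : ℕ → Ω → TX dT dX}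
    (hlaw : ∀ i, HasLaw (Z i) P.fst μ) (hindep : iIndepFun Z μ) {W₀ : ℝ} (hW₀ : 0 < W₀)
    (hac : targetTX P ≪ P.fst)
    (hdens : ∀ᵐ z ∂P.fst, (targetTX P).rnDeriv P.fst z ≤ ENNReal.ofReal W₀)
    {W : ℝ} (hW : W₀ < W) {lam : ℝ} (hlam : 0 ≤ lam) {ρ : ℝ → ℝ}
    (hρ : ContinuousOn ρ (Set.Icc 0 W)) {F : Set (P.fst.support → ℝ)} (hF : IsControlled F)
    {w : ∀ n : ℕ, Ω → Fin n → ℝ}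
    (hw : ∀ᵐ ω ∂μ, ∀ n : ℕ, 1 ≤ n →
      IsCBDMWeights P.fst.support F ρ lam W (fun i : Fin n => Z i ω) (w n ω)) :
    ∀ᵐ ω ∂μ, ∀ g : BoundedContinuousFunction (TX dT dX) ℝ,
      Tendsto (fun n : ℕ => ∑ i : Fin n, w n ω i * g (Z i ω)) atTop
        (𝓝 (∫ z, g z ∂targetTX P)) := by
  obtain ⟨r, hr, hr0, hrW, hrQ⟩ := exists_bounded_density P hW₀.le hac hdens
  have hKT : IsCompact P.fst.fst.support := isCompact_support_map h𝒵 continuous_fst measurable_fst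
  have hKX : IsCompact P.fst.snd.support := isCompact_support_map h𝒵 continuous_snd measurable_snd
  have hlawT : ∀ i, HasLaw (fun ω => (Z i ω).1) P.fst.fst μ := fun i =>
    hasLaw_comp (hlaw i) measurable_fst
  have hlawX : ∀ i, HasLaw (fun ω => (Z i ω).2) P.fst.snd μ := fun i =>
    hasLaw_comp (hlaw i) measurable_snd
  let νT : ProbabilityMeasure (EuclideanSpace ℝ (Fin dT)) := ⟨P.fst.fst, inferInstance⟩
  let νX : ProbabilityMeasure (EuclideanSpace ℝ (Fin dX)) := ⟨P.fst.snd, inferInstance⟩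
  have hT := ae_tendsto_empirical hlaw hindep measurable_fst hKT νT rfl
  have hX := ae_tendsto_empirical hlaw hindep measurable_snd hKX νX rfl
  have hr' : ∀ᵐ ω ∂μ, Tendsto (fun n : ℕ => weightedEmpirical
      (fun i : Fin n => (n : ℝ)⁻¹ * r (Z i ω)) fun i => Z i ω) atTop
      (𝓝 (⟨targetTX P, inferInstance⟩ : FiniteMeasure (TX dT dX))) :=
    ae_tendsto_weightedEmpirical (φ := fun z => z) hlaw hindep measurable_id h𝒵
      (ae_mem_support hlaw) hr hr0 hrW _ (hac Measure.measure_compl_support) fun g => hrQ _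
  filter_upwards [hw, ae_mem_support hlaw, ae_mem_support hlawT, ae_mem_support hlawX, hT, hX, hr']
    with ω hw hZ hZT hZX hT hX hr'
  have hrlim : ∀ g : BoundedContinuousFunction (TX dT dX) ℝ,
      Tendsto (fun n : ℕ => ∑ i : Fin n, (n : ℝ)⁻¹ * r (Z i ω) * g (Z i ω)) atTop
        (𝓝 (∫ z, g z ∂targetTX P)) := fun g =>
    (FiniteMeasure.tendsto_iff_forall_integral_tendsto.1 hr' g).congr fun n =>
      integral_weightedEmpirical (fun i => mul_nonneg (by positivity) (hr0 _)) _
  have hmass : Tendsto (fun n : ℕ => ∑ i : Fin n, (n : ℝ)⁻¹ * r (Z i ω)) atTop (𝓝 1) := by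
    simpa using hrlim (BoundedContinuousFunction.const _ 1)
  have hfeas := eventually_normalized_mem_feasible (r := fun i => r (Z i ω)) hW₀ hW
    (fun i => hr0 _) (fun i => hrW _) hmass
  have hw' : ∀ᶠ n : ℕ in atTop,
      IsCBDMWeights P.fst.support F ρ lam W (fun i : Fin n => Z i ω) (w n ω) :=
    (eventually_ge_atTop 1).mono hw
  refine tendsto_sum_of_isCBDMWeights (z := fun i => Z i ω) (w := fun n => w n ω) h𝒵 hF hρ hlam hZ
    (v := fun n i => (n : ℝ)⁻¹ * r (Z i ω) / ∑ j : Fin n, (n : ℝ)⁻¹ * r (Z j ω)) ?_ ?_ hfeas ?_ hw'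
  · filter_upwards [eventually_ne_atTop 0] with n hn
    exact productEmpirical_carrier h𝒵.measurableSet hKT.measurableSet hKX.measurableSet
      (support_prod_support_subset P hac) hn (fun i => hZT i) fun i => hZX i
  · exact tendsto_integral_prod (α' := νT) (β' := νX) ((eventually_ne_atTop 0).mono fun n hn =>
      isProbabilityMeasure_empirical hn) ((eventually_ne_atTop 0).mono fun n hn =>
      isProbabilityMeasure_empirical hn) hT hX
  · intro g
    have h1 := (hrlim g).div hmass one_ne_zero
    rw [div_one] at h1
    refine h1.congr fun n => ?_
    rw [Pi.div_apply, Finset.sum_div]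
    exact Finset.sum_congr rfl fun i _ => by ring

end Main

end CBDM

theorem mainTheorem3 {Ω : Type*} [MeasurableSpace Ω] (μ : Measure Ω) [IsProbabilityMeasure μ]
    {dT dX : ℕ}
    -- the distribution `P` of `((T, X), Y)`, with compact supports
    (P : Measure (CBDM.TX dT dX × ℝ)) [IsProbabilityMeasure P]
    (hZcompact : IsCompact P.fst.support) (hYcompact : IsCompact P.snd.support)
    -- i.i.d. observations `(T i, X i, Y i)` with distribution `P`
    (T : ℕ → Ω → EuclideanSpace ℝ (Fin dT)) (X : ℕ → Ω → EuclideanSpace ℝ (Fin dX))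
    (Y : ℕ → Ω → ℝ)
    (hlaw : ∀ i, HasLaw (fun ω => ((T i ω, X i ω), Y i ω)) P μ)
    (hindep : iIndepFun (fun i ω => ((T i ω, X i ω), Y i ω)) μ)
    -- overlap: absolute continuity and bounded density
    (W₀ : ℝ) (hW₀ : 0 < W₀)
    (hac : CBDM.targetTX P ≪ P.fst)
    (hdens : ∀ᵐ z ∂P.fst, (CBDM.targetTX P).rnDeriv P.fst z ≤ ENNReal.ofReal W₀)
    -- clipping constant and regularizer
    (W : ℝ) (hW : W₀ < W) (lam : ℝ) (hlam : 0 ≤ lam)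
    (ρ : ℝ → ℝ) (hρconv : StrictConvexOn ℝ (Set.Icc 0 W) ρ)
    (hρcont : ContinuousOn ρ (Set.Icc 0 W)) (hρdiff : DifferentiableOn ℝ ρ (Set.Ioo 0 W))
    -- the IPM is `W₁`, or `MMD_K` for a universal kernel `K` on the support of `P_{T,X}`
    (F : Set (P.fst.support → ℝ))
    (hF : F = CBDM.lipschitzClass P.fst.support ∨
      ∃ (K : P.fst.support → P.fst.support → ℝ) (hK : CBDM.IsKernel K),
        CBDM.IsUniversal K hK ∧ F = CBDM.mmdClass K hK)
    -- the CBDM weights, built on the sample `Z 0, …, Z (n - 1)` with `Z i = (T i, X i)`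
    (w : ∀ n : ℕ, (Fin n → CBDM.TX dT dX) → Fin n → ℝ) (hwmeas : ∀ n, Measurable (w n))
    (hw : ∀ᵐ ω ∂μ, ∀ n : ℕ, 1 ≤ n →
      CBDM.IsCBDMWeights P.fst.support F ρ lam W (fun i : Fin n => (T i ω, X i ω))
        (w n fun i : Fin n => (T i ω, X i ω))) :
    -- almost surely, weak convergence of `∑ i, w i • δ_{(Z i, Y i)}` to `Q`
    ∀ᵐ ω ∂μ,
      Tendsto
        (fun n : ℕ => CBDM.weightedEmpirical (w n fun i : Fin n => (T i ω, X i ω))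
          (fun i : Fin n => ((T i ω, X i ω), Y i ω)))
        atTop (𝓝 (CBDM.interventional P).toFiniteMeasure) := by
  set D : ℕ → Ω → CBDM.TX dT dX × ℝ := fun i ω => ((T i ω, X i ω), Y i ω)
  have hlawZ : ∀ i, HasLaw (fun ω => (D i ω).1) P.fst μ := fun i =>
    CBDM.hasLaw_comp (hlaw i) measurable_fst
  have hlawY : ∀ i, HasLaw (fun ω => (D i ω).2) P.snd μ := fun i =>
    CBDM.hasLaw_comp (hlaw i) measurable_snd
  have hindepZ : iIndepFun (fun i ω => (D i ω).1) μ :=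
    hindep.comp (fun _ => Prod.fst) fun _ => measurable_fst
  have hW' : 0 < W := hW₀.trans hW
  have hcov := CBDM.ae_tendsto_sum_covariates hZcompact hlawZ hindepZ hW₀ hac hdens hW hlam hρcont
    (CBDM.isControlled_of_eq_or hZcompact hF) (w := fun n ω => w n fun i : Fin n => (D i ω).1) hw
  have hwbd : ∀ᵐ ω ∂μ, ∀ᶠ n : ℕ in atTop, ∀ i,
      |w n (fun i : Fin n => (D i ω).1) i| ≤ W / n := by
    filter_upwards [hw] with ω hω
    filter_upwards [eventually_ge_atTop 1] with n hn i
    rw [abs_of_nonneg ((hω n hn).1.1.1 i)]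
    exact (hω n hn).1.2 i
  have hsum : ∀ h : BoundedContinuousFunction (CBDM.TX dT dX × ℝ) ℝ, ∀ᵐ ω ∂μ,
      Tendsto (fun n : ℕ => ∑ i : Fin n, w n (fun i : Fin n => (D i ω).1) i * h (D i ω)) atTop
        (𝓝 (∫ p, h p ∂(CBDM.interventional P : Measure (CBDM.TX dT dX × ℝ)))) := by
    intro h
    have hh : Measurable h := h.continuous.measurable
    have hb : ∀ p, |h p| ≤ ‖h‖ := h.norm_coe_le_norm
    have hm : Measurable fun z => ∫ y, h (z, y) ∂P.condKernel z :=
      (StronglyMeasurable.integral_kernel_prod_right' (κ := P.condKernel)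
        hh.stronglyMeasurable).measurable
    have hmb : ∀ z, |∫ y, h (z, y) ∂P.condKernel z| ≤ ‖h‖ := fun z => by
      simpa using norm_integral_le_of_norm_le_const (μ := P.condKernel z) (f := fun y => h (z, y))
        (ae_of_all _ fun y => hb (z, y))
    have h1 := CBDM.ae_tendsto_sum_of_measurable hlawZ hindepZ hW₀.le
      (CBDM.targetTX_le_smul P hac hdens) hm hmb hW'.le hwbd hcov
    -- The weights satisfy their bounds only almost surely along the sample, while Hoeffding needs
    -- them for every `z`. Clipping to `[0, W / n]` provides this and almost surely changes nothing
    -- for `n ≥ 1`.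
    have h2 := CBDM.ae_tendsto_weighted_sum_sub hlaw hindep hh hb
      (w := fun n z i => max 0 (min (w n z i) (W / n))) (W := W)
      (fun n => measurable_pi_lambda _ fun i => measurable_const.max
        (((measurable_pi_apply i).comp (hwmeas n)).min measurable_const))
      fun n z i => by
        rw [abs_of_nonneg (le_max_left _ _)]
        exact max_le (by positivity) (min_le_right _ _)
    have hQ : ∫ p, h p ∂(CBDM.interventional P : Measure (CBDM.TX dT dX × ℝ)) =
        ∫ z, ∫ y, h (z, y) ∂P.condKernel z ∂CBDM.targetTX P :=
      Measure.integral_compProd (h.integrable _)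
    rw [hQ]
    filter_upwards [h1, h2, hw] with ω h1 h2 hω
    have h3 := h2.add h1
    rw [zero_add] at h3
    refine h3.congr' ?_
    filter_upwards [eventually_ge_atTop 1] with n hn
    rw [← Finset.sum_add_distrib]
    refine Finset.sum_congr rfl fun i _ => ?_
    have h4 : max 0 (min (w n (fun j : Fin n => (D j ω).1) i) (W / n)) =
        w n (fun j : Fin n => (D j ω).1) i := by
      rw [min_eq_left ((hω n hn).1.2 i), max_eq_right ((hω n hn).1.1.1 i)]
    rw [h4]
    ring
  obtain ⟨g, hg⟩ := CBDM.exists_seq_forall_tendsto (hZcompact.prod hYcompact)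
  have hcarrier : (CBDM.interventional P : Measure (CBDM.TX dT dX × ℝ))
      (P.fst.support ×ˢ P.snd.support)ᶜ = 0 := by
    have hPK : ∀ᵐ p ∂P, p ∈ P.fst.support ×ˢ P.snd.support := by
      have h1 : ∀ᵐ z ∂P.fst, z ∈ P.fst.support := Measure.support_mem_ae
      have h2 : ∀ᵐ y ∂P.snd, y ∈ P.snd.support := Measure.support_mem_ae
      filter_upwards [ae_of_ae_map measurable_fst.aemeasurable h1,
        ae_of_ae_map measurable_snd.aemeasurable h2] with p h1 h2 using ⟨h1, h2⟩
    -- `P` and `Q` share the outcome kernel, so overlap of the covariate laws lifts to the joint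
    -- laws and `Q` inherits the compact carrier of `P`.
    have h3 : CBDM.targetTX P ⊗ₘ P.condKernel ≪ P := by
      have := hac.compProd_left P.condKernel
      rwa [P.disintegrate] at this
    exact h3 hPK
  filter_upwards [hw, CBDM.ae_mem_support hlawZ, CBDM.ae_mem_support hlawY,
    ae_all_iff.2 fun k => hsum (g k)] with ω hω hZ hY hk
  refine hg _ _ 1 (Eventually.of_forall fun n => CBDM.weightedEmpirical_compl_eq_zero
    (hZcompact.prod hYcompact).measurableSet fun i => ⟨hZ i, hY i⟩) hcarrier ?_ fun k => ?_
  · filter_upwards [eventually_ge_atTop 1] with n hn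
    rw [CBDM.weightedEmpirical_real_univ (hω n hn).1.1.1]
    exact (hω n hn).1.1.2.le
  · refine (hk k).congr' ?_
    filter_upwards [eventually_ge_atTop 1] with n hn
    rw [CBDM.integral_weightedEmpirical (hω n hn).1.1.1]
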